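/- For $k$-point sets $A=\{a_1,\dots,a_k\}$ and $B=\{b_1,\dots,b_k\}$ in Euclidean space (points may coincide) let $\mathcal M(A,B)=\min_{\pi}\sum_{j=1}^k\|a_j-b_{\pi(j)}\|^2$, the minimum being over all permutations $\pi$ of $\{1,\dots,k\}$. An instance is a family $\mathbb P=(P_1,\dots,P_n)$ of $k$-point sets in $\mathbb R^d$, with $n,k\ge 1$. Fix $\alpha>1$. For an instance $\mathbb P$ and an index $i_0$ put $$L_{\mathbb P}=\sum_{l=1}^n\mathcal M(P_l,P_{i_0}),\qquad t_{\mathbb P}(P_i)=8(\alpha+1)\frac{\mathcal M(P_i,P_{i_0})}{L_{\mathbb P}}+\frac{4\alpha+16}{n},\qquad T_{\mathbb P}=\sum_{i=1}^n t_{\mathbb P}(P_i)$$ (the first summand of $t_{\mathbb P}$ is read as $0$ if $L_{\mathbb P}=0$). Given indices $s_1,\dots,s_r$ and weights $w_1,\dots,w_n$, say that the weighted sample $P_{s_1},\dots,P_{s_r}$ satisfies the coreset inequality with error $\eta$ if $$\Big|\sum_{l=1}^n\mathcal M(P_l,Q)-\sum_{j=1}^r w_{s_j}\mathcal M(P_{s_j},Q)\Big|\le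 \eta\sum_{l=1}^n\mathcal M(P_l,Q)$$ for every $k$-point set $Q$ in the ambient space of $\mathbb P$ with $\mathcal M(Q,P_{i_0})\le 4L_{\mathbb P}/n$. Theorem. For all $\alpha>1$ and $\delta>0$ there are constants $c,C,K>0$, depending only on $\alpha$ and $\delta$, such that the following holds for all $n,k\ge1$, $d\ge 0$, $0<\epsilon<1$, every instance $\mathbb P$ of $n$ many $k$-point sets in $\mathbb R^d$, and every integer $r\ge\big\lceil C\,\frac{k}{\epsilon^4}\log^2\frac{2nk}{\epsilon}\big\rceil$; in particular for a sample size $r=\tilde O(k/\epsilon^4)$ that does not depend on $d$. Let $m=\lceil c\log(2nk)/\epsilon^2\rceil$, and carry out the following experiment. 1. (Johnson–Lindenstrauss projection) Draw a random $m\times d$ matrix $G$ with independent entries from a common law with mean $0$, variance $1$ and $\mathbb E\,e^{tX}\le e^{t^2/2}$ for all $t\in\mathbb R$ (for instance standard Gaussians or random signs), and let $\mathbb P'=(P_1',\dots,P_n')$ be the image of $\mathbb P$ under $x\mapsto m^{-1/2}Gx$, an instance in $\mathbb R^m$. 2. Draw $i_0\in\{1,\dots,n\}$ uniformly at random, independently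 of $G$. 3. Given $G$ and $i_0$, draw $s_1,\dots,s_r$ independently from the distribution $t_{\mathbb P'}(P'_i)/T_{\mathbb P'}$ on $\{1,\dots,n\}$, and give the index $l$ the weight $w_l=\frac1r\,\frac{T_{\mathbb P'}}{t_{\mathbb P'}(P'_l)}$. Then, with probability at least $1-\frac1\alpha-\delta$, the sample $P_{s_1},\dots,P_{s_r}$ with these weights satisfies the coreset inequality with error $K\epsilon$ for the given instance $\mathbb P$ (for all $Q\subset\mathbb R^d$ with $\mathcal M(Q,P_{i_0})\le 4L_{\mathbb P}/n$), and at the same time the sample $P'_{s_1},\dots,P'_{s_r}$ with the same weights satisfies it for the projected instance $\mathbb P'$ (for all $Q'\subset\mathbb R^m$ with $\mathcal M(Q',P'_{i_0})\le 4L_{\mathbb P'}/n$). -/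

import Mathlib

open MeasureTheory ProbabilityTheory

noncomputable section

namespace GeomPrototype

/-- A `k`-point set in `ℝ^d`, listed as `a₁, …, a_k` (coincidences are allowed). -/
abbrev PointSet (k d : ℕ) : Type := Fin k → EuclideanSpace ℝ (Fin d)

/-- An instance: `n` many `k`-point sets `P₁, …, P_n` in `ℝ^d`. -/
abbrev Instance (n k d : ℕ) : Type := Fin n → PointSet k d

/-- The matching cost `M(A, B) = min_π ∑ⱼ ‖aⱼ - b_{π(j)}‖²` over all permutations `π`
(a minimum of finitely many reals). -/
def matchCost {k d : ℕ} (A B : PointSet k d) : ℝ :=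
  ⨅ π : Equiv.Perm (Fin k), ∑ j, ‖A j - B (π j)‖ ^ 2

/-- The cost `∑_l M(P_l, Q)` of a candidate prototype `Q`. -/
def cost {n k d : ℕ} (P : Instance n k d) (Q : PointSet k d) : ℝ :=
  ∑ l, matchCost (P l) Q

/-- The upper bound `t(P_i) = 8(α+1) M(P_i, P_{i₀}) / L + (4α+16)/n` on the sensitivity of `P_i`,
where `L = ∑_l M(P_l, P_{i₀})`. If `L = 0`, then all `M(P_i, P_{i₀})` vanish, and so does the first
summand. -/
def sensBound {n k d : ℕ} (α : ℝ) (P : Instance n k d) (i₀ i : Fin n) : ℝ :=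
  8 * (α + 1) * (matchCost (P i) (P i₀) / cost P (P i₀)) + (4 * α + 16) / n

/-- The sum `T = ∑_i t(P_i)`. -/
def sensTotal {n k d : ℕ} (α : ℝ) (P : Instance n k d) (i₀ : Fin n) : ℝ :=
  ∑ i, sensBound α P i₀ i

/-- The distribution `t(P_i) / T` on the indices `1, …, n`. -/
def samplingLaw {n k d : ℕ} (α : ℝ) (P : Instance n k d) (i₀ : Fin n) : Measure (Fin n) :=
  ∑ i, ENNReal.ofReal (sensBound α P i₀ i / sensTotal α P i₀) • Measure.dirac i

/-- The weight `w_l = (1/r) · T / t(P_l)` of a sampled `P_l`, for sample size `r`. -/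
def sampleWeight {n k d : ℕ} (α : ℝ) (P : Instance n k d) (i₀ : Fin n) (r : ℕ) (l : Fin n) : ℝ :=
  1 / r * (sensTotal α P i₀ / sensBound α P i₀ l)

/-- The coreset inequality with relative error `η`, for the sample `P_{s(1)}, …, P_{s(r)}` (a point
set drawn several times is counted as often) with weights `w`, for every `k`-point set `Q` with
`M(Q, P_{i₀}) ≤ 4 L / n`, where `L = ∑_l M(P_l, P_{i₀})`. -/
def IsLocalCoreset {n k d r : ℕ} (P : Instance n k d) (i₀ : Fin n) (w : Fin n → ℝ)
    (s : Fin r → Fin n) (η : ℝ) : Prop :=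
  ∀ Q : PointSet k d, matchCost Q (P i₀) ≤ 4 * cost P (P i₀) / n →
    |cost P Q - ∑ j, w (s j) * matchCost (P (s j)) Q| ≤ η * cost P Q

/-- Admissible laws of the entries of a Johnson–Lindenstrauss matrix: mean `0`, variance `1`, and
`E exp(tX) ≤ exp(t²/2)` for all real `t`. The standard Gaussian law, random signs, and the
sparse law on `{-√3, 0, √3}` with probabilities `1/6, 2/3, 1/6` are all of this kind. -/
structure IsJLEntryLaw (ν : Measure ℝ) : Prop where
  isProbabilityMeasure : IsProbabilityMeasure ν
  mean_eq_zero : ∫ x, x ∂ν = 0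
  variance_eq_one : ∫ x, x ^ 2 ∂ν = 1
  subgaussian : HasSubgaussianMGF id 1 ν

/-- The law of an `m × d` matrix with independent entries of law `ν`. -/
def jlLaw (ν : Measure ℝ) (m d : ℕ) : Measure (Fin m → Fin d → ℝ) :=
  Measure.pi fun _ => Measure.pi fun _ => ν

/-- The linear map `x ↦ m^{-1/2} G x` from `ℝ^d` to `ℝ^m`. -/
def jlMap {m d : ℕ} (G : Fin m → Fin d → ℝ) (x : EuclideanSpace ℝ (Fin d)) :
    EuclideanSpace ℝ (Fin m) :=
  WithLp.toLp 2 fun a => (∑ b, G a b * x b) / √(m : ℝ)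

/-- The projected instance. -/
def jlProject {n k m d : ℕ} (G : Fin m → Fin d → ℝ) (P : Instance n k d) : Instance n k m :=
  fun i j => jlMap G (P i j)

/-- The target dimension `⌈c log(2nk) / ε²⌉` of the projection. -/
def jlDim (c : ℝ) (n k : ℕ) (ε : ℝ) : ℕ := ⌈c * Real.log (2 * n * k) / ε ^ 2⌉₊

/-- The sample size `⌈C (k / ε⁴) log²(2nk/ε)⌉`. -/
def sampleSize (C : ℝ) (n k : ℕ) (ε : ℝ) : ℕ :=
  ⌈C * (k / ε ^ 4) * Real.log (2 * n * k / ε) ^ 2⌉₊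

/-- The probability of the event `E` in the following experiment: draw a matrix `G` with independent
entries of law `ν` and project `P` to `P' ⊂ ℝ^m`; draw `i₀` uniformly from the `n` indices,
independently of `G`; given these two, draw `s(1), …, s(r)` independently from the
distribution `t(P'_i) / T` of the projected instance `P'`.
(The integrals are lower integrals, so a lower bound needs no measurability of `E`.) -/
def experimentProb {n k d : ℕ} (α : ℝ) (ν : Measure ℝ) (m r : ℕ) (P : Instance n k d)
    (E : (Fin m → Fin d → ℝ) → Fin n → (Fin r → Fin n) → Prop) : ENNReal :=
  ∫⁻ G, ∫⁻ i₀, (Measure.pi fun _ : Fin r => samplingLaw α (jlProject G P) i₀) {s | E G i₀ s}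
    ∂(uniformOn (Set.univ : Set (Fin n))) ∂(jlLaw ν m d)

end GeomPrototype

end

namespace GeomPrototype

/-! Fix o = P_{i₀} and view k-point sets as offset vectors from o in ℝ^{kd}. Then M(P_i, Q) is the
minimum over orderings a of P_i of ‖a - u‖², where u is an offset of Q, so it depends on Q only
through ‖u‖ and the inner products of u with n·k! vectors. A greedy approximation recovers these
inner products, up to the needed error, from about 1/ε² signed choices among those vectors. Hence
the local Q fall into (2nk)^{O(k/ε²)}·O(1/ε) classes, a count free of d (`exists_key`). Hoeffding
for one representative per class and a union bound give a uniform law of large numbers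
(`measureReal_exists_deviation_le`). Its additive error is a relative one: every Q costs at least a
quarter of A, the average over i of the cost of P_i (`spread_le`), and M(P_i, Q)/p_i = O(A) once
p_i·A dominates M(P_i, o) + A/n up to a constant (`measureReal_not_isLocalCoreset_le`).

The projection only supplies the probabilities p_i. They may be off by constant factors, so constant
distortion is enough: matching costs within the instance shrink by at most a factor 4
(`IsJLEntryLaw.measureReal_matchCost_shrinks_le`), and their total grows by at most a constant
factor (`IsJLEntryLaw.measureReal_spread_lt_le`). Markov over i₀ makes o nearly average in both
instances. The sampling lemma then applies to each instance separately; no Q is carried from one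
space to the other. -/

/-! ### Matching costs. -/

lemma matchCost_le {k d : ℕ} (A B : PointSet k d) (π : Equiv.Perm (Fin k)) :
    matchCost A B ≤ ∑ j, ‖A j - B (π j)‖ ^ 2 :=
  ciInf_le (Set.finite_range _).bddBelow π

lemma exists_matchCost_eq {k d : ℕ} (A B : PointSet k d) :
    ∃ π : Equiv.Perm (Fin k), ∑ j, ‖A j - B (π j)‖ ^ 2 = matchCost A B :=
  exists_eq_ciInf_of_finite

lemma matchCost_nonneg {k d : ℕ} (A B : PointSet k d) : 0 ≤ matchCost A B :=
  Real.iInf_nonneg fun _ => by positivity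

lemma cost_nonneg {n k d : ℕ} (P : Instance n k d) (Q : PointSet k d) : 0 ≤ cost P Q :=
  Finset.sum_nonneg fun _ _ => matchCost_nonneg _ _

lemma matchCost_comm {k d : ℕ} (A B : PointSet k d) : matchCost A B = matchCost B A := by
  have key : ∀ A B : PointSet k d, matchCost A B ≤ matchCost B A := fun A B => by
    obtain ⟨π, hπ⟩ := exists_matchCost_eq B A
    rw [← hπ, ← Equiv.sum_comp π⁻¹]
    refine (matchCost_le A B π⁻¹).trans_eq (Finset.sum_congr rfl fun j _ => ?_)
    rw [norm_sub_rev]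
    simp
  exact le_antisymm (key A B) (key B A)

/-- Compose optimal matchings and use (a + b)² ≤ 2a² + 2b² pointwise. -/
lemma matchCost_triangle {k d : ℕ} (A B C : PointSet k d) :
    matchCost A C ≤ 2 * matchCost A B + 2 * matchCost B C := by
  obtain ⟨π, hπ⟩ := exists_matchCost_eq A B
  obtain ⟨σ, hσ⟩ := exists_matchCost_eq B C
  rw [← hπ, ← hσ, ← Equiv.sum_comp π (fun j => ‖B j - C (σ j)‖ ^ 2), Finset.mul_sum,
    Finset.mul_sum, ← Finset.sum_add_distrib]
  refine (matchCost_le A C (σ * π)).trans (Finset.sum_le_sum fun j _ => ?_)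
  have h := norm_sub_le_norm_sub_add_norm_sub (A j) (B (π j)) (C (σ (π j)))
  have h0 := norm_nonneg (A j - C (σ (π j)))
  simp only [Equiv.Perm.mul_apply]
  nlinarith [sq_nonneg (‖A j - B (π j)‖ - ‖B (π j) - C (σ (π j))‖)]

/-! ### Greedy sparse approximation. -/

/-- The increment `ε • x i`, `-ε • x i` or `0` of a greedy sparse approximation. -/
noncomputable def greedyStep {ι H : Type*} [NormedAddCommGroup H] [InnerProductSpace ℝ H]
    (x : ι → H) (ε : ℝ) : Option (ι × Bool) → H
  | none => 0
  | some (i, true) => ε • x i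
  | some (i, false) => -(ε • x i)

/-- Greedy sparse approximation: a vector of norm at most `√T ε` is, up to `ε` in every
direction `x i`, a sum of `T` signed multiples `ε • x i`. -/
lemma exists_greedy_approx {ι H : Type*} [NormedAddCommGroup H] [InnerProductSpace ℝ H]
    (x : ι → H) (hx : ∀ i, ‖x i‖ ≤ 1) {ε : ℝ} (hε : 0 ≤ ε) (T : ℕ) :
    ∀ u : H, ‖u‖ ^ 2 ≤ T * ε ^ 2 → ∃ a : Fin T → Option (ι × Bool),
      ∀ i, |inner ℝ (x i) (u - ∑ t, greedyStep x ε (a t))| ≤ ε := by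
  induction T with
  | zero =>
    intro u hu
    have : u = 0 := by
      rw [← norm_eq_zero]
      have := norm_nonneg u
      simp at hu
      simp [hu]
    exact ⟨Fin.elim0, fun i => by simpa [this] using hε⟩
  | succ T ih =>
    intro u hu
    by_cases hgood : ∀ i, |inner ℝ (x i) u| ≤ ε
    · exact ⟨fun _ => none, fun i => by simpa [greedyStep] using hgood i⟩
    · push Not at hgood
      obtain ⟨i, hi⟩ := hgood
      -- A violated direction pays for a step: if ⟨x i, u⟩ > ε, then ‖u - ε x i‖² ≤ ‖u‖² - 2ε² + ε²,
      -- so each step uses up ε² of the budget T ε².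
      obtain ⟨s, hs⟩ : ∃ s : Option (ι × Bool), ‖u - greedyStep x ε s‖ ^ 2 ≤ T * ε ^ 2 := by
        have hxi : ε ^ 2 * ‖x i‖ ^ 2 ≤ ε ^ 2 := by
          have := hx i
          have := norm_nonneg (x i)
          exact mul_le_of_le_one_right (sq_nonneg _) (by nlinarith)
        push_cast at hu
        rcases lt_abs.1 hi with h | h
        · refine ⟨some (i, true), ?_⟩
          simp only [greedyStep]
          rw [norm_sub_sq_real, inner_smul_right, real_inner_comm, norm_smul, mul_pow,
            Real.norm_eq_abs, sq_abs]
          nlinarith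
        · refine ⟨some (i, false), ?_⟩
          simp only [greedyStep, sub_neg_eq_add]
          rw [norm_add_sq_real, inner_smul_right, real_inner_comm, norm_smul, mul_pow,
            Real.norm_eq_abs, sq_abs]
          nlinarith
      obtain ⟨a, ha⟩ := ih _ hs
      refine ⟨Fin.cons s a, fun j => ?_⟩
      simpa [Fin.sum_univ_succ, sub_sub] using ha j

/-- The version of `exists_greedy_approx` for test vectors of any norm. -/
lemma exists_greedy_approx_of_norm {ι H : Type*} [NormedAddCommGroup H] [InnerProductSpace ℝ H]
    (x : ι → H) {ε : ℝ} (hε : 0 ≤ ε) (T : ℕ) (u : H) (hu : ‖u‖ ^ 2 ≤ T * ε ^ 2) :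
    ∃ a : Fin T → Option (ι × Bool), ∀ i, |inner ℝ (x i)
      (u - ∑ t, greedyStep (fun i => ‖x i‖⁻¹ • x i) ε (a t))| ≤ ε * ‖x i‖ := by
  obtain ⟨a, ha⟩ := exists_greedy_approx (fun i => ‖x i‖⁻¹ • x i) (fun i => by
    rw [norm_smul, norm_inv, norm_norm]
    exact inv_mul_le_one) hε T u hu
  refine ⟨a, fun i => ?_⟩
  rcases eq_or_ne (x i) 0 with h | h
  · simp [h]
  · have h' : 0 < ‖x i‖ := norm_pos_iff.2 h
    have := ha i
    rw [real_inner_smul_left, abs_mul, abs_of_pos (inv_pos.2 h'), inv_mul_le_iff₀ h'] at this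
    linarith

/-! ### Offsets and the classes of local prototypes. -/

/-- The difference of two `k`-point sets, the first one reordered by `π`, as a vector. -/
noncomputable def offset {k d : ℕ} (A B : PointSet k d) (π : Equiv.Perm (Fin k)) :
    PiLp 2 (fun _ : Fin k => EuclideanSpace ℝ (Fin d)) :=
  WithLp.toLp 2 fun l => A (π l) - B l

/-- The base point cancels and only σπ⁻¹ survives. With σ fixed, varying π therefore runs through
all matchings of A and B, so one ordering of each prototype suffices. -/
lemma norm_offset_sub_sq {k d : ℕ} (A B o : PointSet k d) (π σ : Equiv.Perm (Fin k)) :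
    ‖offset A o π - offset B o σ‖ ^ 2 = ∑ j, ‖A j - B ((σ * π⁻¹) j)‖ ^ 2 := by
  rw [PiLp.norm_sq_eq_of_L2, ← Equiv.sum_comp π⁻¹]
  simp [offset]

lemma norm_offset_sq {k d : ℕ} (A o : PointSet k d) (π : Equiv.Perm (Fin k)) :
    ‖offset A o π‖ ^ 2 = ∑ j, ‖A j - o (π⁻¹ j)‖ ^ 2 := by
  rw [PiLp.norm_sq_eq_of_L2, ← Equiv.sum_comp π⁻¹]
  simp [offset]

lemma exists_norm_offset_sq_eq {k d : ℕ} (A o : PointSet k d) :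
    ∃ π, ‖offset A o π‖ ^ 2 = matchCost A o := by
  obtain ⟨π, hπ⟩ := exists_matchCost_eq A o
  exact ⟨π⁻¹, by rw [norm_offset_sq, inv_inv, hπ]⟩

lemma exists_norm_offset_sub_sq_eq {k d : ℕ} (A B o : PointSet k d) (σ : Equiv.Perm (Fin k)) :
    ∃ π, ‖offset A o π - offset B o σ‖ ^ 2 = matchCost A B := by
  obtain ⟨π, hπ⟩ := exists_matchCost_eq A B
  exact ⟨π⁻¹ * σ, by rw [norm_offset_sub_sq, ← hπ]; simp⟩

lemma matchCost_le_norm_offset_sub_sq {k d : ℕ} (A B o : PointSet k d)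
    (π σ : Equiv.Perm (Fin k)) :
    matchCost A B ≤ ‖offset A o π - offset B o σ‖ ^ 2 := by
  rw [norm_offset_sub_sq]
  exact matchCost_le _ _ _

/-- If the offsets `u`, `v` of `Q`, `Q'` from `o` have norm at most `ρ` and nearly the same inner
products with all offsets of `A`, then `A` has nearly the same cost with respect to `Q` and `Q'`. -/
lemma matchCost_le_of_offset_close {k d : ℕ} (A o Q Q' : PointSet k d) (σ τ : Equiv.Perm (Fin k))
    {ρ ε : ℝ} (hρ : 0 ≤ ρ) (hε : 0 ≤ ε) (hQ' : ‖offset Q' o τ‖ ≤ ρ)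
    (hnorm : ‖offset Q o σ‖ ^ 2 - ‖offset Q' o τ‖ ^ 2 ≤ ε * ρ ^ 2)
    (hin : ∀ π, |inner ℝ (offset A o π) (offset Q o σ - offset Q' o τ)|
      ≤ 2 * (ε * ρ * ‖offset A o π‖)) :
    -- With a the offset of A matched optimally to Q', the change of cost is at most 4ερ‖a‖ + ερ².
    -- Here ‖a‖ ≤ ‖a₀‖ + 2ρ, where ‖a₀‖² = M(A, o), and 4ρ‖a₀‖ ≤ 2‖a₀‖² + 2ρ², so 11 = 8 + 1 + 2.
    matchCost A Q ≤ matchCost A Q' + ε * (2 * matchCost A o + 11 * ρ ^ 2) := by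
  obtain ⟨π, hπ⟩ := exists_norm_offset_sub_sq_eq A Q' o τ
  obtain ⟨π₀, hπ₀⟩ := exists_norm_offset_sq_eq A o
  have h1 := matchCost_le_norm_offset_sub_sq A Q o π σ
  have h2 : ‖offset A o π - offset Q' o τ‖ ^ 2 ≤ ‖offset A o π₀ - offset Q' o τ‖ ^ 2 :=
    hπ.trans_le (matchCost_le_norm_offset_sub_sq A Q' o π₀ τ)
  have h3 := abs_le_of_sq_le_sq' h2 (norm_nonneg _)
  have h4 := norm_sub_le (offset A o π₀) (offset Q' o τ)
  have h5 : ‖offset A o π‖ ≤ ‖offset A o π - offset Q' o τ‖ + ‖offset Q' o τ‖ := by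
    simpa using norm_add_le (offset A o π - offset Q' o τ) (offset Q' o τ)
  have h6 : ‖offset A o π‖ ≤ ‖offset A o π₀‖ + 2 * ρ := by linarith [h3.2]
  have h7 := (abs_le.1 (hin π)).1
  rw [inner_sub_right] at h7
  rw [norm_sub_sq_real] at h1 hπ
  rw [← hπ₀, ← hπ]
  have h8 : ε * ρ * ‖offset A o π‖ ≤ ε * ρ * (‖offset A o π₀‖ + 2 * ρ) :=
    mul_le_mul_of_nonneg_left h6 (mul_nonneg hε hρ)
  have h9 : 0 ≤ ε * (‖offset A o π₀‖ - ρ) ^ 2 := by positivity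
  nlinarith

/-- The local `k`-point sets fall into few classes, and each `P i` has nearly the same cost with
respect to all members of a class, in every dimension. -/
lemma exists_key {n k d : ℕ} (P : Instance n k d) (o : PointSet k d) {ρ ε : ℝ} (hρ : 0 < ρ)
    (hε : 0 < ε) (T : ℕ) (hT : 1 ≤ T * ε ^ 2) :
    ∃ key : PointSet k d →
        (Fin T → Option ((Fin n × Equiv.Perm (Fin k)) × Bool)) × Fin (⌊1 / ε⌋₊ + 1),
      ∀ Q Q', matchCost Q o ≤ ρ ^ 2 → matchCost Q' o ≤ ρ ^ 2 → key Q = key Q' →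
        ∀ i, matchCost (P i) Q ≤
          matchCost (P i) Q' + ε * (2 * matchCost (P i) o + 11 * ρ ^ 2) := by
  classical
  choose σ hσ using fun Q : PointSet k d => exists_norm_offset_sq_eq Q o
  have hgreedy : ∀ Q : PointSet k d, ∃ a : Fin T → Option ((Fin n × Equiv.Perm (Fin k)) × Bool),
      matchCost Q o ≤ ρ ^ 2 → ∀ i : Fin n × Equiv.Perm (Fin k),
        |inner ℝ (offset (P i.1) o i.2) (offset Q o (σ Q) - ∑ t, greedyStep
          (fun i : Fin n × Equiv.Perm (Fin k) =>
            ‖offset (P i.1) o i.2‖⁻¹ • offset (P i.1) o i.2) (ε * ρ) (a t))|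
          ≤ ε * ρ * ‖offset (P i.1) o i.2‖ := fun Q => by
    by_cases hQ : matchCost Q o ≤ ρ ^ 2
    · obtain ⟨a, ha⟩ := exists_greedy_approx_of_norm
        (fun i : Fin n × Equiv.Perm (Fin k) => offset (P i.1) o i.2) (mul_pos hε hρ).le T
        (offset Q o (σ Q)) (by
          rw [hσ, mul_pow, ← mul_assoc]
          exact hQ.trans (le_mul_of_one_le_left (sq_nonneg _) hT))
      exact ⟨a, fun _ => ha⟩
    · exact ⟨fun _ => none, fun h => absurd h hQ⟩
  choose a ha using hgreedy
  -- The key is the greedy code together with the squared norm rounded to multiples of ερ². For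
  -- local Q the quotient is at most 1/ε, so the reduction in `Fin.ofNat` changes nothing.
  refine ⟨fun Q => (a Q, Fin.ofNat _ ⌊matchCost Q o / (ε * ρ ^ 2)⌋₊), ?_⟩
  intro Q Q' hQ hQ' hkey i
  have hnorm : ∀ R : PointSet k d, matchCost R o ≤ ρ ^ 2 → ‖offset R o (σ R)‖ ≤ ρ := fun R hR =>
    abs_le_of_sq_le_sq (by rw [hσ]; exact hR) hρ.le |>.trans' (le_abs_self _)
  have hfl : ∀ R : PointSet k d, matchCost R o ≤ ρ ^ 2 →
      ⌊matchCost R o / (ε * ρ ^ 2)⌋₊ < ⌊1 / ε⌋₊ + 1 := fun R hR => by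
    refine Nat.lt_succ_of_le (Nat.floor_le_floor ?_)
    rw [div_le_div_iff₀ (by positivity) hε]
    nlinarith
  simp only [Prod.mk.injEq, Fin.ext_iff, Fin.ofNat] at hkey
  obtain ⟨hk1, hk2⟩ := hkey
  rw [Nat.mod_eq_of_lt (hfl Q hQ), Nat.mod_eq_of_lt (hfl Q' hQ')] at hk2
  refine matchCost_le_of_offset_close (P i) o Q Q' (σ Q) (σ Q') hρ.le hε.le (hnorm _ hQ') ?_ ?_
  · rw [hσ, hσ]
    have h0 : 0 < ε * ρ ^ 2 := by positivity
    have h1 := Nat.lt_floor_add_one (matchCost Q o / (ε * ρ ^ 2))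
    have h2 := Nat.floor_le (div_nonneg (matchCost_nonneg Q' o) h0.le)
    rw [hk2] at h1
    have h3 : matchCost Q o / (ε * ρ ^ 2) - matchCost Q' o / (ε * ρ ^ 2) ≤ 1 := by linarith
    rwa [← sub_div, div_le_one h0] at h3
  · intro π
    have h1 := abs_le.1 (ha Q hQ (i, π))
    have h2 := abs_le.1 (ha Q' hQ' (i, π))
    rw [inner_sub_right] at h1 h2
    rw [hk1] at h1
    rw [inner_sub_right, abs_le]
    constructor <;> linarith [h1.1, h1.2, h2.1, h2.2]

/-! ### Uniform law of large numbers. -/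

/-- Two-sided Hoeffding inequality for an i.i.d. sample of a bounded function. -/
lemma measureReal_deviation_le {Ω : Type*} [MeasurableSpace Ω] (μ : Measure Ω)
    [IsProbabilityMeasure μ] (r : ℕ) {f : Ω → ℝ} (hf : Measurable f) {B η : ℝ} (hB : 0 < B)
    (hη : 0 ≤ η) (hfB : ∀ x, f x ∈ Set.Icc 0 B) :
    (Measure.pi fun _ : Fin r => μ).real {s | r * (η * B) ≤ |∑ j, f (s j) - r * ∫ x, f x ∂μ|}
      ≤ 2 * Real.exp (-2 * r * η ^ 2) := by
  have hsub := hasSubgaussianMGF_of_mem_Icc (μ := μ) hf.aemeasurable (Filter.Eventually.of_forall hfB)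
  have hcoord : ∀ j : Fin r, HasSubgaussianMGF (fun s : Fin r → Ω => f (s j) - ∫ x, f x ∂μ)
      ((‖B - 0‖₊ / 2) ^ 2) (Measure.pi fun _ : Fin r => μ) := fun j =>
    HasSubgaussianMGF.of_map (X := fun x => f x - ∫ x, f x ∂μ)
      (measurable_pi_apply j).aemeasurable
      (by rwa [(measurePreserving_eval (fun _ : Fin r => μ) j).map_eq])
  have hind : iIndepFun (fun (j : Fin r) (s : Fin r → Ω) => f (s j) - ∫ x, f x ∂μ)
      (Measure.pi fun _ : Fin r => μ) :=
    iIndepFun_pi (X := fun _ x => f x - ∫ x, f x ∂μ) fun _ => (hf.sub_const _).aemeasurable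
  have hsum := HasSubgaussianMGF.sum_of_iIndepFun hind (s := Finset.univ) fun j _ => hcoord j
  have hε : 0 ≤ r * (η * B) := by positivity
  have h1 := hsum.measure_ge_le hε
  have h2 := hsum.neg.measure_ge_le hε
  have hexp : Real.exp (-(r * (η * B)) ^ 2 /
      (2 * ((∑ _j : Fin r, (‖B - 0‖₊ / 2) ^ 2 : NNReal) : ℝ))) = Real.exp (-2 * r * η ^ 2) := by
    congr 1
    rcases Nat.eq_zero_or_pos r with h | h
    · simp [h]
    · have : (0 : ℝ) < r := by exact_mod_cast h
      simp [abs_of_pos hB]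
      field_simp
  rw [hexp] at h1 h2
  calc _ ≤ (Measure.pi fun _ : Fin r => μ).real
        ({s | r * (η * B) ≤ ∑ j, (f (s j) - ∫ x, f x ∂μ)} ∪
          {s | r * (η * B) ≤ (-fun s : Fin r → Ω => ∑ j, (f (s j) - ∫ x, f x ∂μ)) s}) := by
        refine measureReal_mono fun s hs => ?_
        simp only [Set.mem_ofPred_eq, le_abs] at hs
        simpa [Finset.sum_sub_distrib] using hs
    _ ≤ _ := (measureReal_union_le _ _).trans (by linarith)

/-- A uniform law of large numbers for a family of bounded functions that falls into finitely many
classes of nearly equal functions. -/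
lemma measureReal_exists_deviation_le {Ω 𝒬 κ : Type*} [MeasurableSpace Ω] [Fintype κ]
    (μ : Measure Ω) [IsProbabilityMeasure μ] (r : ℕ) (S : Set 𝒬) (f : 𝒬 → Ω → ℝ) (key : 𝒬 → κ)
    {B η : ℝ} (hB : 0 < B) (hη : 0 ≤ η) (hf : ∀ q, Measurable (f q))
    (hfB : ∀ q ∈ S, ∀ x, f q x ∈ Set.Icc 0 B)
    (hkey : ∀ q ∈ S, ∀ q' ∈ S, key q = key q' → ∀ x, f q x ≤ f q' x + η * B) :
    (Measure.pi fun _ : Fin r => μ).real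
        {s | ∃ q ∈ S, r * (3 * η * B) < |∑ j, f q (s j) - r * ∫ x, f q x ∂μ|}
      ≤ Fintype.card κ * (2 * Real.exp (-2 * r * η ^ 2)) := by
  classical
  -- One bad event per class: that of a representative q'. Replacing q' by q costs rηB in the sum
  -- and rηB in the mean, so a deviation above 3rηB at q forces one of at least rηB at q'.
  have hcell : ∀ c : κ, ∃ A : Set (Fin r → Ω),
      (Measure.pi fun _ : Fin r => μ).real A ≤ 2 * Real.exp (-2 * r * η ^ 2) ∧
      ∀ q ∈ S, key q = c →
        {s | r * (3 * η * B) < |∑ j, f q (s j) - r * ∫ x, f q x ∂μ|} ⊆ A := fun c => by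
    by_cases h : ∃ q ∈ S, key q = c
    · obtain ⟨q', hq', hc⟩ := h
      refine ⟨_, measureReal_deviation_le μ r (hf q') hB hη (hfB q' hq'), fun q hq hqc s hs => ?_⟩
      have hclose : ∀ x, |f q x - f q' x| ≤ η * B := fun x => by
        have h1 := hkey q hq q' hq' (hqc.trans hc.symm) x
        have h2 := hkey q' hq' q hq (hc.trans hqc.symm) x
        rw [abs_le]
        constructor <;> linarith
      have hint : ∀ p ∈ S, Integrable (f p) μ := fun p hp =>
        Integrable.of_mem_Icc 0 B (hf p).aemeasurable (Filter.Eventually.of_forall (hfB p hp))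
      have h1 : |∑ j, f q (s j) - ∑ j, f q' (s j)| ≤ r * (η * B) := by
        rw [← Finset.sum_sub_distrib]
        refine (Finset.abs_sum_le_sum_abs _ _).trans ?_
        refine (Finset.sum_le_sum fun j _ => hclose (s j)).trans_eq ?_
        simp
      have h2 : |∫ x, f q x ∂μ - ∫ x, f q' x ∂μ| ≤ η * B := by
        rw [← integral_sub (hint q hq) (hint q' hq')]
        refine (norm_integral_le_of_norm_le_const (C := η * B)
          (Filter.Eventually.of_forall fun x => (Real.norm_eq_abs _).trans_le (hclose x))).trans_eq ?_
        simp
      have h3 : |r * (∫ x, f q x ∂μ - ∫ x, f q' x ∂μ)| ≤ r * (η * B) := by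
        rw [abs_mul, Nat.abs_cast]
        exact mul_le_mul_of_nonneg_left h2 (Nat.cast_nonneg r)
      simp only [Set.mem_ofPred_eq] at hs ⊢
      have h4 := abs_add_three (∑ j, f q (s j) - ∑ j, f q' (s j))
        (∑ j, f q' (s j) - r * ∫ x, f q' x ∂μ) (-(r * (∫ x, f q x ∂μ - ∫ x, f q' x ∂μ)))
      rw [abs_neg] at h4
      have h5 : ∑ j, f q (s j) - ∑ j, f q' (s j) + (∑ j, f q' (s j) - r * ∫ x, f q' x ∂μ)
        + -(r * (∫ x, f q x ∂μ - ∫ x, f q' x ∂μ)) = ∑ j, f q (s j) - r * ∫ x, f q x ∂μ := by ring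
      rw [h5] at h4
      linarith
    · refine ⟨∅, by simp; positivity, fun q hq hqc => absurd ⟨q, hq, hqc⟩ h⟩
  choose A hA hsub using hcell
  calc _ ≤ (Measure.pi fun _ : Fin r => μ).real (⋃ c, A c) := by
        refine measureReal_mono ?_
        rintro s ⟨q, hq, hs⟩
        exact Set.mem_iUnion.2 ⟨key q, hsub (key q) q hq rfl hs⟩
    _ ≤ ∑ c, (Measure.pi fun _ : Fin r => μ).real (A c) := measureReal_iUnion_fintype_le _
    _ ≤ ∑ _c : κ, 2 * Real.exp (-2 * r * η ^ 2) := Finset.sum_le_sum fun c _ => hA c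
    _ = _ := by simp

/-! ### Johnson–Lindenstrauss: second moment and lower tail. -/

/-- Uses (1 + u + u²/2)(1 - u + u²/2) = 1 + u⁴/4 ≥ 1. -/
lemma exp_neg_le_quadratic {u : ℝ} (hu : 0 ≤ u) : Real.exp (-u) ≤ 1 - u + u ^ 2 / 2 := by
  have h := Real.quadratic_le_exp_of_nonneg hu
  rw [Real.exp_neg, inv_le_iff_one_le_mul₀ (Real.exp_pos u)]
  have h1 : 0 ≤ 1 - u + u ^ 2 / 2 := by nlinarith [sq_nonneg (u - 1)]
  nlinarith [mul_le_mul_of_nonneg_left h h1, sq_nonneg (u ^ 2)]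

/-- One term of the exponential series at |y|; it bounds a fourth moment by the moment generating
function at ±1. -/
lemma pow_four_le_exp (y : ℝ) : y ^ 4 ≤ 24 * (Real.exp (1 * y) + Real.exp (-1 * y)) := by
  have h := Real.pow_div_factorial_le_exp |y| (abs_nonneg y) 4
  have h1 : Real.exp |y| ≤ Real.exp (1 * y) + Real.exp (-1 * y) := by
    rcases abs_cases y with ⟨h, _⟩ | ⟨h, _⟩ <;> rw [h]
    · simpa using (Real.exp_pos _).le
    · simpa using (Real.exp_pos _).le
  rw [show |y| ^ 4 = y ^ 4 by rw [← abs_pow, abs_of_nonneg (by positivity)]] at h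
  norm_num [Nat.factorial] at h
  norm_num at h1 ⊢
  linarith

/-- For a `1`-sub-Gaussian variable of second moment `1`, the Laplace transform of the square. -/
lemma integral_exp_neg_sq_le {Ω : Type*} [MeasurableSpace Ω] {μ : Measure Ω}
    [IsProbabilityMeasure μ] {Y : Ω → ℝ} (hY : HasSubgaussianMGF Y 1 μ)
    (hY2 : ∫ ω, Y ω ^ 2 ∂μ = 1) :
    ∫ ω, Real.exp (-(1 / 96 * Y ω ^ 2)) ∂μ ≤ Real.exp (-(1 / 192)) := by
  have hint2 : Integrable (fun ω => Y ω ^ 2) μ := (hY.memLp 2).integrable_sq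
  have hint4 : Integrable (fun ω => Y ω ^ 4) μ := by
    have h := (hY.memLp 4).integrable_norm_pow (by norm_num)
    simpa [Real.norm_eq_abs, Even.pow_abs (by decide : Even 4)] using h
  -- Here 96 = 24·(2 + 2), as e^{1/2} ≤ 2. The expansion gives E exp(-sY²) ≤ 1 - s + 48s², which is
  -- smallest at s = 1/96, with value 1 - 1/192.
  have h4 : ∫ ω, Y ω ^ 4 ∂μ ≤ 96 := by
    have hmgf : ∀ t : ℝ, t ^ 2 = 1 → ∫ ω, Real.exp (t * Y ω) ∂μ ≤ 2 := fun t ht => by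
      refine (hY.mgf_le t).trans ?_
      rw [ht]
      have h := Real.exp_one_lt_d9
      have h1 : Real.exp (1 / 2) ^ 2 = Real.exp 1 := by
        rw [← Real.exp_nat_mul]
        norm_num
      norm_num
      have h2 := Real.exp_pos (1 / 2)
      by_contra! hc
      norm_num at h1 h2
      nlinarith
    calc ∫ ω, Y ω ^ 4 ∂μ
        ≤ ∫ ω, 24 * (Real.exp (1 * Y ω) + Real.exp (-1 * Y ω)) ∂μ :=
          integral_mono hint4
            (((hY.integrable_exp_mul 1).add (hY.integrable_exp_mul (-1))).const_mul 24)
            fun ω => pow_four_le_exp (Y ω)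
      _ ≤ 96 := by
          rw [integral_const_mul, integral_add (hY.integrable_exp_mul 1)
            (hY.integrable_exp_mul (-1))]
          linarith [hmgf 1 (by norm_num), hmgf (-1) (by norm_num)]
  have hpoint : ∀ ω, Real.exp (-(1 / 96 * Y ω ^ 2))
      ≤ 1 - 1 / 96 * Y ω ^ 2 + 1 / 18432 * Y ω ^ 4 := fun ω =>
    (exp_neg_le_quadratic (by positivity)).trans_eq (by ring)
  have hint : Integrable (fun ω => 1 - 1 / 96 * Y ω ^ 2 + 1 / 18432 * Y ω ^ 4) μ :=
    ((integrable_const 1).sub (hint2.const_mul _)).add (hint4.const_mul _)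
  have hmeas : AEStronglyMeasurable (fun ω => Real.exp (-(1 / 96 * Y ω ^ 2))) μ :=
    (Real.measurable_exp.comp_aemeasurable
      ((hY.aemeasurable.pow_const 2).const_mul (1 / 96)).neg).aestronglyMeasurable
  have hint' : Integrable (fun ω => 1 - 1 / 96 * Y ω ^ 2) μ :=
    (integrable_const 1).sub (hint2.const_mul _)
  calc ∫ ω, Real.exp (-(1 / 96 * Y ω ^ 2)) ∂μ
      ≤ ∫ ω, (1 - 1 / 96 * Y ω ^ 2 + 1 / 18432 * Y ω ^ 4) ∂μ := by
        refine integral_mono (hint.mono' hmeas (Filter.Eventually.of_forall fun ω => ?_)) hint hpoint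
        rw [Real.norm_eq_abs, Real.abs_exp]
        exact hpoint ω
    _ = 1 - 1 / 96 + 1 / 18432 * ∫ ω, Y ω ^ 4 ∂μ := by
        rw [integral_add hint' (hint4.const_mul _),
          integral_sub (integrable_const 1) (hint2.const_mul _), integral_const_mul,
          integral_const_mul, hY2]
        simp
    _ ≤ -(1 / 192) + 1 := by linarith
    _ ≤ _ := Real.add_one_le_exp _

section Row

variable {ν : Measure ℝ} {d : ℕ}

/-- By independence the parameters x_b² add up to ‖x‖² = 1. -/
lemma IsJLEntryLaw.hasSubgaussianMGF_row (hν : IsJLEntryLaw ν) (x : EuclideanSpace ℝ (Fin d))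
    (hx : ‖x‖ = 1) :
    HasSubgaussianMGF (fun g : Fin d → ℝ => ∑ b, g b * x b) 1 (Measure.pi fun _ => ν) := by
  have := hν.isProbabilityMeasure
  have hind : iIndepFun (fun (b : Fin d) (g : Fin d → ℝ) => x b * g b) (Measure.pi fun _ => ν) :=
    iIndepFun_pi (X := fun b y => x b * y) fun b => (measurable_const_mul (x b)).aemeasurable
  have hcoord : ∀ b, HasSubgaussianMGF (fun g : Fin d → ℝ => g b) 1 (Measure.pi fun _ => ν) :=
    fun b => HasSubgaussianMGF.of_map (X := id) (measurable_pi_apply b).aemeasurable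
      (by rw [(measurePreserving_eval (fun _ : Fin d => ν) b).map_eq]; exact hν.subgaussian)
  have h := HasSubgaussianMGF.sum_of_iIndepFun hind (s := Finset.univ)
    fun b _ => (hcoord b).const_mul (x b)
  simp only [mul_comm (x _)] at h
  convert h using 1
  rw [← NNReal.coe_inj]
  have := EuclideanSpace.real_norm_sq_eq x
  rw [hx] at this
  rw [NNReal.coe_sum, NNReal.coe_one, ← one_pow 2, this]
  exact Finset.sum_congr rfl fun b _ => (mul_one _).symm

lemma IsJLEntryLaw.memLp_id (hν : IsJLEntryLaw ν) : MemLp (fun y : ℝ => y) 2 ν :=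
  hν.subgaussian.memLp 2

lemma IsJLEntryLaw.memLp_row (hν : IsJLEntryLaw ν) (x : EuclideanSpace ℝ (Fin d)) :
    MemLp (fun g : Fin d → ℝ => ∑ b, g b * x b) 2 (Measure.pi fun _ => ν) := by
  have := hν.isProbabilityMeasure
  exact memLp_finsetSum _ fun b _ => (hν.memLp_id.mul_const (x b)).comp_measurePreserving
    (measurePreserving_eval (fun _ : Fin d => ν) b)

lemma IsJLEntryLaw.integral_row_sq (hν : IsJLEntryLaw ν) (x : EuclideanSpace ℝ (Fin d)) :
    ∫ g, (∑ b, g b * x b) ^ 2 ∂(Measure.pi fun _ : Fin d => ν) = ‖x‖ ^ 2 := by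
  have := hν.isProbabilityMeasure
  have hmean : ∫ g, (∑ b, g b * x b) ∂(Measure.pi fun _ : Fin d => ν) = 0 := by
    rw [integral_finsetSum]
    · refine Finset.sum_eq_zero fun b _ => ?_
      rw [integral_mul_const]
      have h := integral_comp_eval (μ := fun _ : Fin d => ν) (i := b) (f := fun y : ℝ => y)
        aestronglyMeasurable_id
      rw [h, hν.mean_eq_zero, zero_mul]
    · intro b _
      exact (((hν.memLp_id.mul_const (x b)).comp_measurePreserving
        (measurePreserving_eval (fun _ : Fin d => ν) b)).integrable (by norm_num))
  have hvar := variance_sum_pi (μ := fun _ : Fin d => ν) (X := fun b y => y * x b)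
    fun b => hν.memLp_id.mul_const (x b)
  rw [show (∑ b, fun g : Fin d → ℝ => g b * x b) = fun g => ∑ b, g b * x b by ext; simp,
    variance_of_integral_eq_zero (hν.memLp_row x).aemeasurable hmean] at hvar
  rw [hvar, EuclideanSpace.real_norm_sq_eq]
  refine Finset.sum_congr rfl fun b _ => ?_
  rw [variance_mul_const, variance_of_integral_eq_zero aemeasurable_id' hν.mean_eq_zero,
    hν.variance_eq_one, one_mul]

end Row

lemma jlMap_sub {m d : ℕ} (G : Fin m → Fin d → ℝ) (x y : EuclideanSpace ℝ (Fin d)) :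
    jlMap G (x - y) = jlMap G x - jlMap G y := by
  ext a
  simp [jlMap, mul_sub, Finset.sum_sub_distrib, sub_div]

lemma jlMap_smul {m d : ℕ} (G : Fin m → Fin d → ℝ) (t : ℝ) (x : EuclideanSpace ℝ (Fin d)) :
    jlMap G (t • x) = t • jlMap G x := by
  ext a
  simp only [jlMap, PiLp.smul_apply, smul_eq_mul, mul_left_comm _ t, ← Finset.mul_sum, mul_div_assoc]

lemma norm_jlMap_sq {m d : ℕ} (G : Fin m → Fin d → ℝ) (x : EuclideanSpace ℝ (Fin d)) :
    ‖jlMap G x‖ ^ 2 = (∑ a, (∑ b, G a b * x b) ^ 2) / m := by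
  rw [EuclideanSpace.real_norm_sq_eq, Finset.sum_div]
  refine Finset.sum_congr rfl fun a _ => ?_
  simp [jlMap, div_pow]

lemma IsJLEntryLaw.integrable_norm_jlMap_sq {ν : Measure ℝ} (hν : IsJLEntryLaw ν) {m d : ℕ}
    (x : EuclideanSpace ℝ (Fin d)) :
    Integrable (fun G : Fin m → Fin d → ℝ => ‖jlMap G x‖ ^ 2) (jlLaw ν m d) := by
  have := hν.isProbabilityMeasure
  simp only [norm_jlMap_sq]
  refine (integrable_finsetSum _ fun a _ => ?_).div_const _
  exact ((hν.memLp_row x).comp_measurePreserving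
    (measurePreserving_eval (fun _ : Fin m => Measure.pi fun _ : Fin d => ν) a)).integrable_sq

lemma IsJLEntryLaw.integral_norm_jlMap_sq {ν : Measure ℝ} (hν : IsJLEntryLaw ν) {m d : ℕ}
    (hm : 0 < m) (x : EuclideanSpace ℝ (Fin d)) :
    ∫ G, ‖jlMap G x‖ ^ 2 ∂(jlLaw ν m d) = ‖x‖ ^ 2 := by
  have := hν.isProbabilityMeasure
  have hmp := fun a : Fin m => measurePreserving_eval
    (fun _ : Fin m => Measure.pi fun _ : Fin d => ν) a
  simp only [norm_jlMap_sq]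
  have hint : ∀ a : Fin m, Integrable (fun G : Fin m → Fin d → ℝ => (∑ b, G a b * x b) ^ 2)
      (Measure.pi fun _ : Fin m => Measure.pi fun _ : Fin d => ν) := fun a =>
    ((hν.memLp_row x).comp_measurePreserving (hmp a)).integrable_sq
  rw [integral_div, jlLaw, integral_finsetSum _ fun a _ => hint a]
  have hterm : ∀ a : Fin m, ∫ G : Fin m → Fin d → ℝ, (∑ b, G a b * x b) ^ 2
      ∂(Measure.pi fun _ : Fin m => Measure.pi fun _ : Fin d => ν) = ‖x‖ ^ 2 := fun a => by
    rw [← hν.integral_row_sq x]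
    exact integral_comp_eval (μ := fun _ : Fin m => Measure.pi fun _ : Fin d => ν)
      (f := fun g : Fin d → ℝ => (∑ b, g b * x b) ^ 2)
      (hν.memLp_row x).integrable_sq.aestronglyMeasurable
  have hm' : (m : ℝ) ≠ 0 := by positivity
  simp only [hterm, Finset.sum_const, Finset.card_univ, Fintype.card_fin, nsmul_eq_mul]
  field_simp

/-- The lower tail in the Johnson–Lindenstrauss lemma. -/
lemma IsJLEntryLaw.measureReal_norm_jlMap_sq_lt_le {ν : Measure ℝ} (hν : IsJLEntryLaw ν) {m d : ℕ}
    (hm : 0 < m) (x : EuclideanSpace ℝ (Fin d)) :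
    (jlLaw ν m d).real {G | ‖jlMap G x‖ ^ 2 < ‖x‖ ^ 2 / 4} ≤ Real.exp (-(m / 384)) := by
  have := hν.isProbabilityMeasure
  have : IsProbabilityMeasure (jlLaw ν m d) := by unfold jlLaw; infer_instance
  have hm' : (0 : ℝ) < m := by exact_mod_cast hm
  rcases eq_or_ne x 0 with rfl | hx
  · have : {G : Fin m → Fin d → ℝ | ‖jlMap G 0‖ ^ 2 < ‖(0 : EuclideanSpace ℝ (Fin d))‖ ^ 2 / 4}
        = ∅ := by
      ext G
      simp
    rw [this]
    simpa using (Real.exp_pos _).le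
  set e := ‖x‖⁻¹ • x with he
  have hx' : 0 < ‖x‖ := norm_pos_iff.2 hx
  have hnorm : ‖e‖ = 1 := by rw [he, norm_smul, norm_inv, norm_norm, inv_mul_cancel₀ hx'.ne']
  have hxe : x = ‖x‖ • e := by rw [he, smul_smul, mul_inv_cancel₀ hx'.ne', one_smul]
  set X : (Fin m → Fin d → ℝ) → ℝ := fun G => ∑ a, (∑ b, G a b * e b) ^ 2 with hX
  have hprod : (fun G => Real.exp (-(1 / 96) * X G))
      = fun G => ∏ a, Real.exp (-(1 / 96 * (∑ b, G a b * e b) ^ 2)) := by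
    ext G
    rw [← Real.exp_sum, hX, Finset.mul_sum]
    simp [neg_mul]
  have hmgf : mgf X (jlLaw ν m d) (-(1 / 96)) ≤ Real.exp (-(1 / 192)) ^ m := by
    rw [mgf, hprod, jlLaw, integral_fintype_prod_eq_pow (μ := Measure.pi fun _ : Fin d => ν)
      (fun g : Fin d → ℝ => Real.exp (-(1 / 96 * (∑ b, g b * e b) ^ 2))), Fintype.card_fin]
    refine pow_le_pow_left₀ (integral_nonneg fun _ => (Real.exp_pos _).le) ?_ m
    refine integral_exp_neg_sq_le (hν.hasSubgaussianMGF_row e hnorm) ?_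
    rw [hν.integral_row_sq, hnorm, one_pow]
  have hint : Integrable (fun G => Real.exp (-(1 / 96) * X G)) (jlLaw ν m d) := by
    have hmeas : Measurable X := by fun_prop
    refine (integrable_const (1 : ℝ)).mono'
      (Real.measurable_exp.comp (hmeas.const_mul _)).aestronglyMeasurable
      (Filter.Eventually.of_forall fun G => ?_)
    rw [Real.norm_eq_abs, Real.abs_exp, Real.exp_le_one_iff]
    have : 0 ≤ X G := Finset.sum_nonneg fun _ _ => sq_nonneg _
    linarith
  calc (jlLaw ν m d).real {G | ‖jlMap G x‖ ^ 2 < ‖x‖ ^ 2 / 4}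
      ≤ (jlLaw ν m d).real {G | X G ≤ m / 4} := by
        refine measureReal_mono fun G hG => ?_
        rw [Set.mem_ofPred_eq] at hG ⊢
        rw [hxe, jlMap_smul, norm_smul, norm_smul, norm_norm, hnorm, mul_pow, norm_jlMap_sq,
          mul_one] at hG
        have hsq : 0 < ‖x‖ ^ 2 := by positivity
        have h : X G / m < 1 / 4 := by
          by_contra! hc
          have := mul_le_mul_of_nonneg_left hc hsq.le
          simp only [hX] at this
          linarith
        rw [div_lt_iff₀ hm'] at h
        linarith
    -- Chernoff: the threshold m/4 costs e^{m/384}, against e^{-m/192} from the m independent rows.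
    _ ≤ Real.exp (-(-(1 / 96)) * (m / 4)) * mgf X (jlLaw ν m d) (-(1 / 96)) :=
        measure_le_le_exp_mul_mgf _ (by norm_num) hint
    _ ≤ Real.exp (-(-(1 / 96)) * (m / 4)) * Real.exp (-(1 / 192)) ^ m :=
        mul_le_mul_of_nonneg_left hmgf (Real.exp_pos _).le
    _ = Real.exp (-(m / 384)) := by
        rw [← Real.exp_nat_mul, ← Real.exp_add]
        congr 1
        ring

/-! ### Importance sampling with dominating probabilities. -/

/-- The sum of all pairwise matching costs of an instance. -/
noncomputable def spread {n k d : ℕ} (P : Instance n k d) : ℝ := ∑ i, cost P (P i)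

lemma spread_nonneg {n k d : ℕ} (P : Instance n k d) : 0 ≤ spread P :=
  Finset.sum_nonneg fun _ _ => cost_nonneg _ _

/-- Route every pair through Q. This bounds the cost of every Q from below on one scale, which turns
additive errors into relative ones. -/
lemma spread_le {n k d : ℕ} (P : Instance n k d) (Q : PointSet k d) :
    spread P ≤ 4 * n * cost P Q := by
  calc spread P ≤ ∑ i, ∑ l, (2 * matchCost (P l) Q + 2 * matchCost (P i) Q) :=
        Finset.sum_le_sum fun i _ => Finset.sum_le_sum fun l _ => by
          rw [matchCost_comm (P i) Q]
          exact matchCost_triangle _ _ _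
    _ = 4 * n * cost P Q := by
        simp only [Finset.sum_add_distrib, ← Finset.mul_sum, Finset.sum_const, Finset.card_univ,
          Fintype.card_fin, nsmul_eq_mul]
        simp only [cost]
        ring

/-- The measure with mass `p i` at the index `i`. -/
noncomputable def weightedLaw {n : ℕ} (p : Fin n → ℝ) : Measure (Fin n) :=
  ∑ i, ENNReal.ofReal (p i) • Measure.dirac i

lemma isProbabilityMeasure_weightedLaw {n : ℕ} {p : Fin n → ℝ} (hp : ∀ i, 0 ≤ p i)
    (hsum : ∑ i, p i = 1) : IsProbabilityMeasure (weightedLaw p) := by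
  constructor
  simp [weightedLaw, ← ENNReal.ofReal_sum_of_nonneg fun i _ => hp i, hsum]

lemma integral_weightedLaw {n : ℕ} {p : Fin n → ℝ} (hp : ∀ i, 0 ≤ p i) (f : Fin n → ℝ) :
    ∫ i, f i ∂(weightedLaw p) = ∑ i, p i * f i := by
  rw [weightedLaw, integral_finsetSum_measure fun i _ =>
    (integrable_dirac (by simp)).smul_measure ENNReal.ofReal_ne_top]
  refine Finset.sum_congr rfl fun i _ => ?_
  rw [integral_smul_measure, integral_dirac, ENNReal.toReal_ofReal (hp i), smul_eq_mul]

/-- Importance sampling gives a local coreset, in every dimension, if the probabilities dominate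
the sensitivities and the reference set `P i₀` is nearly average. -/
lemma measureReal_not_isLocalCoreset_le {n k d r : ℕ} (hn : 0 < n) (hr : 0 < r)
    (P : Instance n k d) (i₀ : Fin n) (p : Fin n → ℝ) (hp : ∀ i, 0 < p i) (hsum : ∑ i, p i = 1)
    {c L ε : ℝ} (hc : 0 < c) (hL : 1 ≤ L) (hε : 0 < ε) (T : ℕ) (hT : 1 ≤ T * ε ^ 2)
    (hcost : cost P (P i₀) ≤ L * (spread P / n))
    (hdom : ∀ i, c * (matchCost (P i) (P i₀) + spread P / n / n) ≤ p i * (spread P / n)) :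
    (Measure.pi fun _ : Fin r => weightedLaw p).real
        {s | ¬ IsLocalCoreset P i₀ (fun l => 1 / r * (1 / p l)) s (576 * L / c * ε)}
      ≤ ((2 * (n * k.factorial) + 1) ^ T * (⌊1 / ε⌋₊ + 1) : ℕ) *
        (2 * Real.exp (-2 * r * (6 * ε) ^ 2)) := by
  have hn' : (0 : ℝ) < n := by exact_mod_cast hn
  have hr' : (0 : ℝ) < r := by exact_mod_cast hr
  have := isProbabilityMeasure_weightedLaw (fun i => (hp i).le) hsum
  set A := spread P / n with hA
  have hA0 : 0 ≤ A := div_nonneg (spread_nonneg P) hn'.le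
  have hAcost : ∀ Q, A ≤ 4 * cost P Q := fun Q => by
    rw [hA, div_le_iff₀ hn']
    linarith [spread_le P Q]
  -- If A = 0, domination makes all M(P_i, o) vanish, hence M(Q, o) = 0 for local Q, and both costs
  -- are 0. Otherwise the radius ρ below is positive.
  rcases hA0.eq_or_lt with h0 | hpos
  · have hempty : {s : Fin r → Fin n |
        ¬ IsLocalCoreset P i₀ (fun l => 1 / r * (1 / p l)) s (576 * L / c * ε)} = ∅ := by
      rw [Set.eq_empty_iff_forall_notMem]
      rintro s hs
      refine hs fun Q hQ => ?_
      have hM : ∀ i, matchCost (P i) Q = 0 := fun i => by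
        have h1 := hdom i
        rw [← h0] at h1 hcost
        have h2 : 4 * cost P (P i₀) / n ≤ 0 :=
          div_nonpos_of_nonpos_of_nonneg (by linarith) hn'.le
        have h3 := matchCost_triangle (P i) (P i₀) Q
        have h4 : matchCost (P i) (P i₀) ≤ 0 := by
          simp only [zero_div, add_zero, mul_zero] at h1
          exact nonpos_of_mul_nonpos_right h1 hc
        rw [matchCost_comm (P i₀) Q] at h3
        linarith [matchCost_nonneg (P i) Q]
      simp [cost, hM]
    rw [hempty]
    simp only [measureReal_empty]
    positivity
  · have hAn : 0 < A / n := by positivity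
    have hρ2 : √(4 * L * (A / n)) ^ 2 = 4 * L * (A / n) := Real.sq_sqrt (by positivity)
    obtain ⟨key, hkey⟩ := exists_key P (P i₀) (ρ := √(4 * L * (A / n)))
      (Real.sqrt_pos.2 (by positivity)) hε T hT
    rw [hρ2] at hkey
    have hB : 0 < 8 * L * A / c := by positivity
    have hdom' : ∀ i, matchCost (P i) (P i₀) + A / n ≤ p i * A / c := fun i => by
      rw [le_div_iff₀ hc]
      linarith [hdom i]
    -- With ρ² = 4LA/n: M(P_i, Q) ≤ 2M(P_i, o) + 2ρ² ≤ 8L(M(P_i, o) + A/n) ≤ B p_i. Within a class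
    -- the change is at most ε(2M(P_i, o) + 44LA/n) ≤ 6εB p_i. Finally 3·6ε·B = 144LεA/c, and A ≤
    -- 4·cost gives 576.
    have hmain := measureReal_exists_deviation_le (weightedLaw p) r
      {Q | matchCost Q (P i₀) ≤ 4 * L * (A / n)} (fun Q i => matchCost (P i) Q / p i) key
      (B := 8 * L * A / c) (η := 6 * ε) hB (by positivity) (fun _ => measurable_of_finite _) ?_ ?_
    · refine (measureReal_mono ?_).trans (hmain.trans_eq ?_)
      · intro s hs
        by_contra hgood
        refine hs fun Q hQ => ?_
        simp only [Set.mem_ofPred_eq, not_exists, not_and, not_lt] at hgood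
        have h1 := hgood Q (hQ.trans (by
          rw [div_le_iff₀ hn']
          have : 4 * L * (A / n) * n = 4 * L * A := by field_simp
          linarith))
        rw [integral_weightedLaw fun i => (hp i).le] at h1
        have h2 : ∑ i, p i * (matchCost (P i) Q / p i) = cost P Q :=
          Finset.sum_congr rfl fun i _ => mul_div_cancel₀ _ (hp i).ne'
        have h3 : ∑ j, 1 / (r : ℝ) * (1 / p (s j)) * matchCost (P (s j)) Q
            = (∑ j, matchCost (P (s j)) Q / p (s j)) / r := by
          rw [Finset.sum_div]
          exact Finset.sum_congr rfl fun j _ => by ring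
        have h4 : cost P Q - (∑ j, matchCost (P (s j)) Q / p (s j)) / r
            = -((∑ j, matchCost (P (s j)) Q / p (s j) - r * cost P Q) / r) := by
          field_simp
          ring
        rw [h3, h4, abs_neg, abs_div, abs_of_pos hr', div_le_iff₀ hr']
        rw [h2] at h1
        refine h1.trans ?_
        have h5 : 0 ≤ 144 * L * ε / c * r := by positivity
        calc r * (3 * (6 * ε) * (8 * L * A / c)) = 144 * L * ε / c * r * A := by ring
          _ ≤ 144 * L * ε / c * r * (4 * cost P Q) := mul_le_mul_of_nonneg_left (hAcost Q) h5
          _ = 576 * L / c * ε * cost P Q * r := by ring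
      · congr 2
        simp [Fintype.card_perm, mul_comm]
    · intro Q hQ i
      have hQ' : matchCost Q (P i₀) ≤ 4 * L * (A / n) := hQ
      refine ⟨div_nonneg (matchCost_nonneg _ _) (hp i).le, ?_⟩
      rw [div_le_iff₀ (hp i)]
      have h1 := matchCost_triangle (P i) (P i₀) Q
      rw [matchCost_comm (P i₀) Q] at h1
      have h2 : 8 * L * A / c * p i = 8 * L * (p i * A / c) := by ring
      rw [h2]
      have h3 := mul_le_mul_of_nonneg_left (hdom' i) (by positivity : 0 ≤ 8 * L)
      have h4 := matchCost_nonneg (P i) (P i₀)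
      nlinarith
    · intro Q hQ Q' hQ' hk i
      have h1 := hkey Q Q' hQ hQ' hk i
      have h2 : matchCost (P i) Q' / p i + 6 * ε * (8 * L * A / c)
          = (matchCost (P i) Q' + 48 * ε * L * (p i * A / c)) / p i := by
        have := (hp i).ne'
        field_simp
        ring
      rw [h2]
      refine div_le_div_of_nonneg_right ?_ (hp i).le
      have h3 := mul_le_mul_of_nonneg_left (hdom' i) (by positivity : 0 ≤ 48 * ε * L)
      have h4 := matchCost_nonneg (P i) (P i₀)
      have h5 : ε * matchCost (P i) (P i₀) ≤ ε * L * matchCost (P i) (P i₀) :=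
        mul_le_mul_of_nonneg_right (le_mul_of_one_le_right hε.le hL) h4
      have h6 : 0 ≤ ε * L * (A / n) := by positivity
      have h7 : 0 ≤ ε * L * matchCost (P i) (P i₀) := by positivity
      nlinarith

/-! ### Sample size against the number of classes. -/

/-- Each greedy choice thus has log-count O(k log(2nk)); this is where the factor k in the sample
size comes from. -/
lemma two_mul_factorial_add_one_le {n k : ℕ} (hn : 0 < n) (hk : 0 < k) :
    2 * (n * k.factorial) + 1 ≤ (2 * n * k) ^ (2 * k) := by
  have h1 := Nat.factorial_le_pow k
  have h2 : 0 < n * k.factorial := Nat.mul_pos hn (Nat.factorial_pos k)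
  have h3 : 4 * n ≤ (4 * n) ^ k := Nat.le_self_pow hk.ne' _
  calc 2 * (n * k.factorial) + 1 ≤ 4 * n * k ^ k := by nlinarith
    _ ≤ (4 * n) ^ k * k ^ k := Nat.mul_le_mul_right _ h3
    _ = (4 * n * k) ^ k := (mul_pow _ _ _).symm
    _ ≤ ((2 * n * k) ^ 2) ^ k := Nat.pow_le_pow_left (by nlinarith [Nat.mul_pos hn hk]) k
    _ = _ := by rw [← pow_mul]

/-- The sample size beats the number of classes of prototypes. -/
lemma card_mul_exp_le {n k r : ℕ} (hn : 0 < n) (hk : 0 < k) {ε C : ℝ} (hε : 0 < ε) (hε1 : ε < 1)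
    (hC : 1 ≤ C) (hr : sampleSize C n k ε ≤ r) :
    (((2 * (n * k.factorial) + 1) ^ ⌈1 / ε ^ 2⌉₊ * (⌊1 / ε⌋₊ + 1) : ℕ) : ℝ) *
      (2 * Real.exp (-2 * r * (6 * ε) ^ 2)) ≤ 2 / C := by
  have hn' : (1 : ℝ) ≤ n := by exact_mod_cast hn
  have hk' : (1 : ℝ) ≤ k := by exact_mod_cast hk
  have hnk : (1 : ℝ) ≤ n * k := by nlinarith
  set W : ℝ := 2 * n * k / ε with hW
  have hWpos : 0 < W := by positivity
  have hW2 : 2 * n * k ≤ W := by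
    rw [hW, le_div_iff₀ hε]
    nlinarith
  set Λ := Real.log W with hΛ
  have hΛ1 : 1 / 2 ≤ Λ := by
    have h1 : Real.log 2 ≤ Λ := Real.log_le_log (by norm_num) (by linarith)
    linarith [Real.log_two_gt_d9]
  have hexpΛ : Real.exp Λ = W := Real.exp_log hWpos
  have hfloor : ((⌊1 / ε⌋₊ : ℝ) + 1) ≤ Real.exp Λ := by
    have h1 := Nat.floor_le (by positivity : 0 ≤ 1 / ε)
    have h2 : 1 ≤ 1 / ε := by rw [le_div_iff₀ hε]; linarith
    have h3 : 2 * (1 / ε) ≤ W := by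
      rw [hW, mul_one_div]
      exact div_le_div_of_nonneg_right (by linarith) hε.le
    linarith
  have hε2 : 1 ≤ 1 / ε ^ 2 := by rw [le_div_iff₀ (by positivity)]; nlinarith
  set T := ⌈1 / ε ^ 2⌉₊
  have hT : (T : ℝ) ≤ 2 * (1 / ε ^ 2) := by
    have := Nat.ceil_lt_add_one (by positivity : 0 ≤ 1 / ε ^ 2)
    linarith
  have hbase : ((2 * (n * k.factorial) + 1 : ℕ) : ℝ) ≤ Real.exp (2 * k * Λ) := by
    calc ((2 * (n * k.factorial) + 1 : ℕ) : ℝ) ≤ (((2 * n * k) ^ (2 * k) : ℕ) : ℝ) := by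
          exact_mod_cast two_mul_factorial_add_one_le hn hk
      _ ≤ W ^ (2 * k) := by
          push_cast
          exact pow_le_pow_left₀ (by positivity) hW2 _
      _ = Real.exp (2 * k * Λ) := by
          rw [← hexpΛ, ← Real.exp_nat_mul]
          push_cast
          rfl
  -- X is the common scale: the log-count is at most 4X from the T choices plus Λ ≤ X from rounding,
  -- while the Hoeffding exponent is at least 72CΛX ≥ 36CX.
  set X := k * Λ * (1 / ε ^ 2) with hX
  have hkΛ : Λ ≤ k * Λ := by nlinarith
  have hX1 : k * Λ ≤ X := by
    rw [hX]
    exact le_mul_of_one_le_right (by nlinarith) hε2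
  have hcard : (((2 * (n * k.factorial) + 1) ^ T * (⌊1 / ε⌋₊ + 1) : ℕ) : ℝ)
      ≤ Real.exp (5 * X) := by
    calc (((2 * (n * k.factorial) + 1) ^ T * (⌊1 / ε⌋₊ + 1) : ℕ) : ℝ)
        = ((2 * (n * k.factorial) + 1 : ℕ) : ℝ) ^ T * ((⌊1 / ε⌋₊ : ℝ) + 1) := by push_cast; ring
      _ ≤ Real.exp (2 * k * Λ) ^ T * Real.exp Λ := by gcongr
      _ = Real.exp (T * (2 * k * Λ) + Λ) := by rw [← Real.exp_nat_mul, ← Real.exp_add]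
      _ ≤ Real.exp (5 * X) := by
          refine Real.exp_le_exp.2 ?_
          have h1 := mul_le_mul_of_nonneg_right hT (by positivity : 0 ≤ 2 * k * Λ)
          have h2 : 2 * (1 / ε ^ 2) * (2 * k * Λ) = 4 * X := by rw [hX]; ring
          linarith
  have hrexp : 36 * C * X ≤ 2 * r * (6 * ε) ^ 2 := by
    have h1 : C * (k / ε ^ 4) * Λ ^ 2 ≤ r := (Nat.le_ceil _).trans (by exact_mod_cast hr)
    have h2 : 2 * (C * (k / ε ^ 4) * Λ ^ 2) * (6 * ε) ^ 2 = 72 * C * Λ * X := by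
      rw [hX]
      field_simp
      ring
    have h3 := mul_le_mul_of_nonneg_right h1 (by positivity : 0 ≤ 2 * (6 * ε) ^ 2)
    have h4 : 0 ≤ C * X := by positivity
    nlinarith
  calc _ ≤ Real.exp (5 * X) * (2 * Real.exp (-(36 * C * X))) := by
        gcongr
        linarith
    _ = 2 * Real.exp (5 * X - 36 * C * X) := by rw [sub_eq_add_neg, Real.exp_add]; ring
    _ ≤ 2 * Real.exp (-C) := by
        gcongr
        have : 1 / 2 ≤ X := by linarith
        nlinarith
    _ ≤ 2 / C := by
        rw [div_eq_mul_inv, Real.exp_neg]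
        gcongr
        linarith [Real.add_one_le_exp C]

/-! ### Effect of the projection and of the random reference set. -/

lemma norm_jlMap_sub {m d : ℕ} (G : Fin m → Fin d → ℝ) (x y : EuclideanSpace ℝ (Fin d)) :
    ‖jlMap G x - jlMap G y‖ = ‖jlMap G (x - y)‖ := by rw [jlMap_sub]

/-- With high probability, the projection shrinks no matching cost by more than a factor `4`. -/
lemma IsJLEntryLaw.measureReal_matchCost_shrinks_le {ν : Measure ℝ} (hν : IsJLEntryLaw ν)
    {n k m d : ℕ} (hm : 0 < m) (P : Instance n k d) :
    (jlLaw ν m d).real {G | ¬ ∀ i l, matchCost (P i) (P l) ≤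
        4 * matchCost (jlProject G P i) (jlProject G P l)}
      ≤ (n * k : ℝ) ^ 2 * Real.exp (-(m / 384)) := by
  have := hν.isProbabilityMeasure
  have : IsProbabilityMeasure (jlLaw ν m d) := by unfold jlLaw; infer_instance
  calc _ ≤ (jlLaw ν m d).real (⋃ q : (Fin n × Fin k) × (Fin n × Fin k),
        {G | ‖jlMap G (P q.1.1 q.1.2 - P q.2.1 q.2.2)‖ ^ 2
          < ‖P q.1.1 q.1.2 - P q.2.1 q.2.2‖ ^ 2 / 4}) := by
        refine measureReal_mono fun G hG => ?_
        by_contra hgood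
        simp only [Set.mem_iUnion, Set.mem_ofPred_eq, not_exists, not_lt] at hgood
        refine hG fun i l => ?_
        -- The optimal matching after projection is also a candidate before it, so lower tails for
        -- the (nk)² differences of points suffice.
        obtain ⟨π, hπ⟩ := exists_matchCost_eq (jlProject G P i) (jlProject G P l)
        refine (matchCost_le _ _ π).trans ?_
        rw [← hπ, Finset.mul_sum]
        refine Finset.sum_le_sum fun j _ => ?_
        have := hgood ((i, j), (l, π j))
        simp only [jlProject]
        rw [norm_jlMap_sub]
        linarith
    _ ≤ ∑ q : (Fin n × Fin k) × (Fin n × Fin k), (jlLaw ν m d).real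
        {G | ‖jlMap G (P q.1.1 q.1.2 - P q.2.1 q.2.2)‖ ^ 2
          < ‖P q.1.1 q.1.2 - P q.2.1 q.2.2‖ ^ 2 / 4} := measureReal_iUnion_fintype_le _
    _ ≤ ∑ _q : (Fin n × Fin k) × (Fin n × Fin k), Real.exp (-(m / 384)) :=
        Finset.sum_le_sum fun q _ => hν.measureReal_norm_jlMap_sq_lt_le hm _
    _ = _ := by
        simp
        ring

/-- By Markov's inequality, the projection rarely increases the spread much. -/
lemma IsJLEntryLaw.measureReal_spread_lt_le {ν : Measure ℝ} (hν : IsJLEntryLaw ν)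
    {n k m d : ℕ} (hm : 0 < m) (P : Instance n k d) {τ : ℝ} (hτ : 0 < τ) :
    (jlLaw ν m d).real {G | spread P < τ * spread (jlProject G P)} ≤ τ := by
  have := hν.isProbabilityMeasure
  have : IsProbabilityMeasure (jlLaw ν m d) := by unfold jlLaw; infer_instance
  -- Matchings optimal before projection do not depend on G. The resulting Z dominates the projected
  -- spread and has mean exactly `spread P`.
  choose π hπ using fun i l => exists_matchCost_eq (P l) (P i)
  set Z : (Fin m → Fin d → ℝ) → ℝ := fun G =>
    ∑ i, ∑ l, ∑ j, ‖jlMap G (P l j - P i (π i l j))‖ ^ 2 with hZ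
  have hle : ∀ G, spread (jlProject G P) ≤ Z G := fun G =>
    Finset.sum_le_sum fun i _ => Finset.sum_le_sum fun l _ =>
      (matchCost_le _ _ (π i l)).trans_eq (Finset.sum_congr rfl fun j _ => by
        simp only [jlProject]
        rw [norm_jlMap_sub])
  have hterm : ∀ i l j, Integrable
      (fun G : Fin m → Fin d → ℝ => ‖jlMap G (P l j - P i (π i l j))‖ ^ 2) (jlLaw ν m d) :=
    fun i l j => hν.integrable_norm_jlMap_sq _
  have hl : ∀ i l, Integrable
      (fun G : Fin m → Fin d → ℝ => ∑ j, ‖jlMap G (P l j - P i (π i l j))‖ ^ 2) (jlLaw ν m d) :=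
    fun i l => integrable_finsetSum _ fun j _ => hterm i l j
  have hi : ∀ i, Integrable (fun G : Fin m → Fin d → ℝ =>
      ∑ l, ∑ j, ‖jlMap G (P l j - P i (π i l j))‖ ^ 2) (jlLaw ν m d) :=
    fun i => integrable_finsetSum _ fun l _ => hl i l
  have hint : Integrable Z (jlLaw ν m d) := integrable_finsetSum _ fun i _ => hi i
  have hZ0 : ∀ G, 0 ≤ Z G := fun G => (spread_nonneg _).trans (hle G)
  have hexp : ∫ G, Z G ∂(jlLaw ν m d) = spread P := by
    rw [hZ, integral_finsetSum _ fun i _ => hi i]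
    refine Finset.sum_congr rfl fun i _ => ?_
    rw [integral_finsetSum _ fun l _ => hl i l]
    refine Finset.sum_congr rfl fun l _ => ?_
    rw [integral_finsetSum _ fun j _ => hterm i l j, ← hπ]
    exact Finset.sum_congr rfl fun j _ => hν.integral_norm_jlMap_sq hm _
  rcases (spread_nonneg P).eq_or_lt with h0 | hpos
  · have hae : Z =ᵐ[jlLaw ν m d] 0 := by
      rw [← integral_eq_zero_iff_of_nonneg hZ0 hint, hexp, h0]
    have hnull : ∀ᵐ G ∂(jlLaw ν m d), ¬ spread P < τ * spread (jlProject G P) := by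
      filter_upwards [hae] with G hG0
      rw [← h0, not_lt]
      exact (mul_le_mul_of_nonneg_left (hle G) hτ.le).trans_eq (by rw [hG0, Pi.zero_apply, mul_zero])
    rw [ae_iff] at hnull
    simp only [not_not] at hnull
    rw [measureReal_def, hnull]
    simpa using hτ.le
  · have hmarkov := mul_meas_ge_le_integral_of_nonneg (Filter.Eventually.of_forall hZ0) hint
      (spread P / τ)
    rw [hexp, div_mul_eq_mul_div, div_le_iff₀ hτ] at hmarkov
    refine (measureReal_mono fun G hG => ?_).trans (le_of_mul_le_mul_left hmarkov hpos)
    rw [Set.mem_ofPred_eq] at hG ⊢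
    rw [div_le_iff₀ hτ, mul_comm]
    exact hG.le.trans (mul_le_mul_of_nonneg_left (hle G) hτ.le)

/-- By Markov's inequality, few reference sets are much worse than average. -/
lemma measureReal_uniformOn_lt_cost_le {n k d : ℕ} (hn : 0 < n) (P : Instance n k d) {L : ℝ}
    (hL : 0 < L) :
    (uniformOn (Set.univ : Set (Fin n))).real {i | L * (spread P / n) < cost P (P i)} ≤ 1 / L := by
  classical
  have hn' : (0 : ℝ) < n := by exact_mod_cast hn
  set B := Finset.univ.filter fun i => L * (spread P / n) < cost P (P i) with hB
  have hunif : (uniformOn (Set.univ : Set (Fin n))).real {i | L * (spread P / n) < cost P (P i)}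
      = (B.card : ℝ) / n := by
    rw [measureReal_def, show {i | L * (spread P / n) < cost P (P i)} = (B : Set (Fin n)) by
      ext; simp [hB], uniformOn_univ, Measure.count_apply_finset]
    simp
  rw [hunif, div_le_div_iff₀ hn' hL, one_mul]
  rcases B.eq_empty_or_nonempty with h | h
  · simp [h]
  · have h1 : ∑ _i ∈ B, L * (spread P / n) < ∑ i ∈ B, cost P (P i) :=
      Finset.sum_lt_sum_of_nonempty h fun i hi => (Finset.mem_filter.1 hi).2
    have h2 : ∑ i ∈ B, cost P (P i) ≤ spread P :=
      Finset.sum_le_univ_sum_of_nonneg fun i => cost_nonneg P (P i)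
    rw [Finset.sum_const, nsmul_eq_mul] at h1
    have h3 : (B.card : ℝ) * (L * (spread P / n)) = B.card * L * spread P / n := by ring
    have h4 : B.card * L * spread P < n * spread P := by
      rw [h3, div_lt_iff₀ hn'] at h1
      nlinarith
    exact (lt_of_mul_lt_mul_right h4 (spread_nonneg P)).le

/-! ### Sampling probabilities of the projected instance. -/

/-- The sampling probability `t(P_i) / T`. -/
noncomputable def sampleProb {n k d : ℕ} (α : ℝ) (P : Instance n k d) (i₀ i : Fin n) : ℝ :=
  sensBound α P i₀ i / sensTotal α P i₀

lemma matchCost_le_cost {n k d : ℕ} (P : Instance n k d) (Q : PointSet k d) (i : Fin n) :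
    matchCost (P i) Q ≤ cost P Q :=
  Finset.single_le_sum (fun l _ => matchCost_nonneg (P l) Q) (Finset.mem_univ i)

section Sampling

variable {n k d : ℕ} {α : ℝ}

lemma le_sensBound (hα : 1 < α) (P : Instance n k d) (i₀ i : Fin n) :
    8 * (matchCost (P i) (P i₀) / cost P (P i₀) + 1 / n) ≤ sensBound α P i₀ i := by
  have h1 : 0 ≤ matchCost (P i) (P i₀) / cost P (P i₀) :=
    div_nonneg (matchCost_nonneg _ _) (cost_nonneg _ _)
  have h2 : (8 : ℝ) / n ≤ (4 * α + 16) / n :=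
    div_le_div_of_nonneg_right (by linarith) (Nat.cast_nonneg n)
  have h3 : 8 * (1 / (n : ℝ)) = 8 / n := by ring
  unfold sensBound
  nlinarith

lemma sensBound_pos (hn : 0 < n) (hα : 1 < α) (P : Instance n k d) (i₀ i : Fin n) :
    0 < sensBound α P i₀ i := by
  have h1 : 0 ≤ matchCost (P i) (P i₀) / cost P (P i₀) :=
    div_nonneg (matchCost_nonneg _ _) (cost_nonneg _ _)
  exact lt_of_lt_of_le (by positivity) (le_sensBound hα P i₀ i)

lemma sensTotal_pos (hn : 0 < n) (hα : 1 < α) (P : Instance n k d) (i₀ : Fin n) :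
    0 < sensTotal α P i₀ :=
  Finset.sum_pos (fun i _ => sensBound_pos hn hα P i₀ i) ⟨i₀, Finset.mem_univ _⟩

/-- The first summands add up to 8(α + 1), or to 0 if the cost vanishes, and the second to 4α + 16.
-/
lemma sensTotal_le (hn : 0 < n) (hα : 1 < α) (P : Instance n k d) (i₀ : Fin n) :
    sensTotal α P i₀ ≤ 12 * α + 24 := by
  have hn' : (n : ℝ) ≠ 0 := by positivity
  have h : sensTotal α P i₀
      = 8 * (α + 1) * (cost P (P i₀) / cost P (P i₀)) + (4 * α + 16) := by
    simp only [sensTotal, sensBound]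
    rw [Finset.sum_add_distrib, ← Finset.mul_sum, ← Finset.sum_div]
    simp only [Finset.sum_const, Finset.card_univ, Fintype.card_fin, nsmul_eq_mul]
    rw [mul_div_cancel₀ _ hn']
    rfl
  have h1 : cost P (P i₀) / cost P (P i₀) ≤ 1 := div_self_le_one _
  nlinarith

lemma sampleProb_pos (hn : 0 < n) (hα : 1 < α) (P : Instance n k d) (i₀ i : Fin n) :
    0 < sampleProb α P i₀ i :=
  div_pos (sensBound_pos hn hα P i₀ i) (sensTotal_pos hn hα P i₀)

lemma sum_sampleProb (hn : 0 < n) (hα : 1 < α) (P : Instance n k d) (i₀ : Fin n) :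
    ∑ i, sampleProb α P i₀ i = 1 := by
  simp only [sampleProb]
  rw [← Finset.sum_div]
  exact div_self (sensTotal_pos hn hα P i₀).ne'

lemma le_sampleProb (hn : 0 < n) (hα : 1 < α) (P : Instance n k d) (i₀ i : Fin n) :
    8 / (12 * α + 24) * (matchCost (P i) (P i₀) / cost P (P i₀) + 1 / n) ≤ sampleProb α P i₀ i := by
  rw [sampleProb, div_mul_eq_mul_div]
  exact div_le_div₀ (sensBound_pos hn hα P i₀ i).le (le_sensBound hα P i₀ i)
    (sensTotal_pos hn hα P i₀) (sensTotal_le hn hα P i₀)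

/-- The sampling probabilities of one instance dominate the sensitivities of another instance with
comparable matching costs. -/
lemma le_sampleProb_mul_of_comparable {m : ℕ} (hn : 0 < n) (hα : 1 < α) (P : Instance n k d)
    (P' : Instance n k m) (i₀ i : Fin n) {A b : ℝ} (hA : 0 ≤ A) (hb : 1 ≤ b)
    (hM : matchCost (P i) (P i₀) ≤ 4 * matchCost (P' i) (P' i₀))
    (hcost : cost P' (P' i₀) ≤ b * A) :
    8 / (12 * α + 24) / (4 * b) * (matchCost (P i) (P i₀) + A / n) ≤ sampleProb α P' i₀ i * A := by
  have ha : 0 < 8 / (12 * α + 24) := by positivity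
  have hM0 := matchCost_nonneg (P i) (P i₀)
  have hM0' := matchCost_nonneg (P' i) (P' i₀)
  have h1 : matchCost (P i) (P i₀) / (4 * b)
      ≤ matchCost (P' i) (P' i₀) / cost P' (P' i₀) * A := by
    -- A vanishing projected cost gives M(P'_i, P'_{i₀}) = 0, and then no shrinking gives M(P_i,
    -- P_{i₀}) = 0.
    rcases (cost_nonneg P' (P' i₀)).eq_or_lt with h0 | hpos
    · have h2 := matchCost_le_cost P' (P' i₀) i
      have h3 : matchCost (P i) (P i₀) = 0 := by linarith
      simp [h3, ← h0]
    · rw [div_mul_eq_mul_div, div_le_div_iff₀ (by positivity) hpos]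
      nlinarith [mul_le_mul hM hcost hpos.le (by positivity)]
  have h2 : A / n / (4 * b) ≤ 1 / n * A := by
    rw [one_div_mul_eq_div]
    exact div_le_self (by positivity) (by linarith)
  calc 8 / (12 * α + 24) / (4 * b) * (matchCost (P i) (P i₀) + A / n)
      = 8 / (12 * α + 24) * (matchCost (P i) (P i₀) / (4 * b) + A / n / (4 * b)) := by ring
    _ ≤ 8 / (12 * α + 24) *
        (matchCost (P' i) (P' i₀) / cost P' (P' i₀) * A + 1 / n * A) := by gcongr
    _ = 8 / (12 * α + 24) * (matchCost (P' i) (P' i₀) / cost P' (P' i₀) + 1 / n) * A := by ring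
    _ ≤ _ := mul_le_mul_of_nonneg_right (le_sampleProb hn hα P' i₀ i) hA

lemma samplingLaw_eq_weightedLaw (P : Instance n k d) (i₀ : Fin n) :
    samplingLaw α P i₀ = weightedLaw (sampleProb α P i₀) := rfl

lemma sampleWeight_eq (P : Instance n k d) (i₀ : Fin n) (r : ℕ) :
    sampleWeight α P i₀ r = fun l => 1 / r * (1 / sampleProb α P i₀ l) := by
  ext l
  rw [sampleWeight, sampleProb, one_div_div]

/-- A sample drawn with the probabilities of `P'` is likely to be a local coreset of `P`, if the two
instances have comparable matching costs. -/
lemma measureReal_samplingLaw_not_isLocalCoreset_le {m r : ℕ} (hn : 0 < n) (hk : 0 < k)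
    (hα : 1 < α) (P : Instance n k d) (P' : Instance n k m) (i₀ : Fin n) {C L b ε : ℝ}
    (hC : 1 ≤ C) (hL : 1 ≤ L) (hb : 1 ≤ b) (hε : 0 < ε) (hε1 : ε < 1) (hr : 0 < r)
    (hrC : sampleSize C n k ε ≤ r)
    (hM : ∀ i, matchCost (P i) (P i₀) ≤ 4 * matchCost (P' i) (P' i₀))
    (hcost : cost P (P i₀) ≤ L * (spread P / n))
    (hcost' : cost P' (P' i₀) ≤ b * (spread P / n)) :
    (Measure.pi fun _ : Fin r => samplingLaw α P' i₀).real
        {s | ¬ IsLocalCoreset P i₀ (sampleWeight α P' i₀ r) s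
          (576 * L / (8 / (12 * α + 24) / (4 * b)) * ε)} ≤ 2 / C := by
  rw [samplingLaw_eq_weightedLaw, sampleWeight_eq]
  refine (measureReal_not_isLocalCoreset_le hn hr P i₀ _ (sampleProb_pos hn hα P' i₀)
    (sum_sampleProb hn hα P' i₀) (by positivity) hL hε ⌈1 / ε ^ 2⌉₊ ?_ hcost fun i =>
      le_sampleProb_mul_of_comparable hn hα P P' i₀ i
        (div_nonneg (spread_nonneg P) (Nat.cast_nonneg n)) hb (hM i) hcost').trans
    (card_mul_exp_le hn hk hε hε1 hC hrC)
  rw [← div_le_iff₀ (by positivity)]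
  exact Nat.le_ceil _

end Sampling

/-! ### Combining the failure probabilities. -/

/-- A lower integral is large if the integrand is large off a set of small outer measure. -/
lemma ofReal_le_lintegral_of_measureReal_le {Ω : Type*} [MeasurableSpace Ω] (μ : Measure Ω)
    [IsProbabilityMeasure μ] {B : Set Ω} {g : Ω → ENNReal} {a β : ℝ} (ha : a ≤ 1)
    (hβ : 0 ≤ β) (hB : μ.real B ≤ β) (hg : ∀ x ∉ B, ENNReal.ofReal a ≤ g x) :
    ENNReal.ofReal (a - β) ≤ ∫⁻ x, g x ∂μ := by
  rcases le_total a 0 with h0 | h0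
  · rw [ENNReal.ofReal_of_nonpos (by linarith)]
    exact zero_le
  -- The bad set need not be measurable; its measurable hull has the same measure.
  set A := (toMeasurable μ B)ᶜ
  have hA : MeasurableSet A := (measurableSet_toMeasurable μ B).compl
  have hAB : ∀ x ∈ A, x ∉ B := fun x hx hxB => hx (subset_toMeasurable μ B hxB)
  have hμA : 1 - β ≤ μ.real A := by
    rw [probReal_compl_eq_one_sub (measurableSet_toMeasurable μ B), measureReal_def,
      measure_toMeasurable, ← measureReal_def]
    linarith
  calc ENNReal.ofReal (a - β) ≤ ENNReal.ofReal (a * μ.real A) := by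
        refine ENNReal.ofReal_le_ofReal ?_
        nlinarith
    _ = ENNReal.ofReal a * μ A := by
        rw [ENNReal.ofReal_mul h0, ofReal_measureReal]
    _ = ∫⁻ _ in A, ENNReal.ofReal a ∂μ := (setLIntegral_const _ _).symm
    _ ≤ ∫⁻ x in A, g x ∂μ := setLIntegral_mono' hA fun x hx => hg x (hAB x hx)
    _ ≤ ∫⁻ x, g x ∂μ := setLIntegral_le_lintegral _ _

lemma le_measureReal_and {Ω : Type*} [MeasurableSpace Ω] (μ : Measure Ω) [IsProbabilityMeasure μ]
    {p q : Ω → Prop} {a b : ℝ} (hp : μ.real {x | ¬ p x} ≤ a) (hq : μ.real {x | ¬ q x} ≤ b) :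
    1 - (a + b) ≤ μ.real {x | p x ∧ q x} := by
  have hsub : (Set.univ : Set Ω) ⊆ {x | p x ∧ q x} ∪ ({x | ¬ p x} ∪ {x | ¬ q x}) := fun x _ => by
    by_cases hpx : p x
    · by_cases hqx : q x
      · exact Or.inl ⟨hpx, hqx⟩
      · exact Or.inr (Or.inr hqx)
    · exact Or.inr (Or.inl hpx)
  have h1 := measureReal_mono (μ := μ) hsub
  have h2 := measureReal_union_le (μ := μ) {x | p x ∧ q x} ({x | ¬ p x} ∪ {x | ¬ q x})
  have h3 := measureReal_union_le (μ := μ) {x | ¬ p x} {x | ¬ q x}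
  rw [probReal_univ] at h1
  linarith

/-- In the exponent, 2Λ cancels (nk)² and (2/τ)Λ ≥ 1/τ leaves e^{-1/τ} ≤ τ. -/
lemma sq_mul_exp_jlDim_le {n k : ℕ} (hn : 0 < n) (hk : 0 < k) {ε τ : ℝ} (hε : 0 < ε)
    (hε1 : ε < 1) (hτ : 0 < τ) :
    (n * k : ℝ) ^ 2 * Real.exp (-(jlDim (384 * (2 + 2 / τ)) n k ε / 384)) ≤ τ := by
  have hn' : (1 : ℝ) ≤ n := by exact_mod_cast hn
  have hk' : (1 : ℝ) ≤ k := by exact_mod_cast hk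
  have hnk : (1 : ℝ) ≤ n * k := by nlinarith
  set Λ := Real.log (2 * n * k) with hΛ
  have hexp : Real.exp Λ = 2 * n * k := Real.exp_log (by positivity)
  have hΛ1 : 1 / 2 ≤ Λ := by
    have h1 : Real.log 2 ≤ Λ := Real.log_le_log (by norm_num) (by linarith)
    linarith [Real.log_two_gt_d9]
  have hdim : (2 + 2 / τ) * Λ ≤ jlDim (384 * (2 + 2 / τ)) n k ε / 384 := by
    rw [le_div_iff₀ (by norm_num)]
    refine le_trans ?_ (Nat.le_ceil _)
    rw [le_div_iff₀ (by positivity), ← hΛ]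
    have : 0 ≤ (2 + 2 / τ) * Λ * 384 := by positivity
    calc (2 + 2 / τ) * Λ * 384 * ε ^ 2 ≤ (2 + 2 / τ) * Λ * 384 :=
          mul_le_of_le_one_right this (by nlinarith)
      _ = _ := by ring
  have h1 : 1 / τ ≤ 2 / τ * Λ := by
    rw [div_mul_eq_mul_div]
    exact div_le_div_of_nonneg_right (by linarith) hτ.le
  have h2 : Real.exp (-(1 / τ)) ≤ τ := by
    rw [Real.exp_neg, inv_le_comm₀ (Real.exp_pos _) hτ, ← one_div]
    linarith [Real.add_one_le_exp (1 / τ)]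
  calc (n * k : ℝ) ^ 2 * Real.exp (-(jlDim (384 * (2 + 2 / τ)) n k ε / 384))
      ≤ Real.exp Λ ^ 2 * Real.exp (-(2 * Λ) + -(1 / τ)) := by
        gcongr
        · rw [hexp]
          linarith
        · linarith
    _ = Real.exp (-(1 / τ)) := by
        rw [← Real.exp_nat_mul, ← Real.exp_add]
        congr 1
        push_cast
        ring
    _ ≤ τ := h2

end GeomPrototype

theorem mainTheorem3 (α : ℝ) (hα : 1 < α) (δ : ℝ) (hδ : 0 < δ) :
    ∃ c C K : ℝ, 0 < c ∧ 0 < C ∧ 0 < K ∧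
      ∀ (ν : MeasureTheory.Measure ℝ), GeomPrototype.IsJLEntryLaw ν →
      ∀ (n k d : ℕ), 0 < n → 0 < k →
      ∀ (ε : ℝ), 0 < ε → ε < 1 →
      ∀ (P : GeomPrototype.Instance n k d) (r : ℕ), GeomPrototype.sampleSize C n k ε ≤ r →
        ENNReal.ofReal (1 - 1 / α - δ) ≤
          GeomPrototype.experimentProb α ν (GeomPrototype.jlDim c n k ε) r P
            (fun G i₀ s =>
              -- the coreset inequality for the given instance, for all `Q ⊂ ℝ^d`
              GeomPrototype.IsLocalCoreset P i₀
                (GeomPrototype.sampleWeight α (GeomPrototype.jlProject G P) i₀ r) s (K * ε) ∧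
              -- the same inequality for the projected instance, in the reduced dimension
              GeomPrototype.IsLocalCoreset (GeomPrototype.jlProject G P) i₀
                (GeomPrototype.sampleWeight α (GeomPrototype.jlProject G P) i₀ r) s (K * ε)) := by
  open GeomPrototype in
  -- All failure probabilities are at most `η`, and there are six of them.
  set η := min δ 1 / 6 with hη
  have hη0 : 0 < η := by positivity
  have hη6 : 6 * η ≤ δ := by rw [hη]; linarith [min_le_left δ 1]
  have hη1 : 6 * η ≤ 1 := by rw [hη]; linarith [min_le_right δ 1]
  have hinv : 1 ≤ 1 / η := by rw [le_div_iff₀ hη0]; linarith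
  -- C = 2/η makes the sampling failure 2/C = η, and L = 1/η is the Markov factor for i₀. The factor
  -- b = 1/η² combines Markov for i₀ with Markov for the spread.
  refine ⟨384 * (2 + 2 / η), 2 / η,
    576 * (1 / η) / (8 / (12 * α + 24) / (4 * (1 / η / η))), by positivity, by positivity,
    by positivity, ?_⟩
  intro ν hν n k d hn hk ε hε hε1 P r hr
  have hn' : (1 : ℝ) ≤ n := by exact_mod_cast hn
  have hk' : (1 : ℝ) ≤ k := by exact_mod_cast hk
  have hnk : (1 : ℝ) ≤ n * k := by nlinarith
  have hC : 1 ≤ 2 / η := by rw [le_div_iff₀ hη0]; linarith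
  have hb : 1 ≤ 1 / η / η := by rw [le_div_iff₀ hη0]; linarith
  have hCη : 2 / (2 / η) = η := div_div_cancel₀ (by norm_num)
  have hm : 0 < jlDim (384 * (2 + 2 / η)) n k ε := by
    have : 0 < Real.log (2 * n * k) := Real.log_pos (by linarith)
    exact Nat.ceil_pos.2 (by positivity)
  have hr0 : 0 < r := by
    refine lt_of_lt_of_le (Nat.ceil_pos.2 ?_) hr
    have : 0 < Real.log (2 * n * k / ε) :=
      Real.log_pos (by rw [lt_div_iff₀ hε]; linarith)
    positivity
  have := hν.isProbabilityMeasure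
  have : IsProbabilityMeasure (jlLaw ν (jlDim (384 * (2 + 2 / η)) n k ε) d) := by
    unfold jlLaw
    infer_instance
  have : Nonempty (Fin n) := ⟨⟨0, hn⟩⟩
  have : IsProbabilityMeasure (uniformOn (Set.univ : Set (Fin n))) :=
    isProbabilityMeasure_uniformOn Set.finite_univ Set.univ_nonempty
  have h1α : 0 < 1 / α := by positivity
  -- Each of the three random choices, G, i₀ and s, loses 2η; the term 1/α is given away.
  refine (ENNReal.ofReal_le_ofReal (by linarith :
    1 - 1 / α - δ ≤ (1 - 2 * η - 2 * η) - 2 * η)).trans ?_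
  refine ofReal_le_lintegral_of_measureReal_le _ (by linarith) (by linarith)
    ((measureReal_union_le _ _).trans (add_le_add
      ((hν.measureReal_matchCost_shrinks_le hm P).trans (sq_mul_exp_jlDim_le hn hk hε hε1 hη0))
      (hν.measureReal_spread_lt_le hm P hη0)) |>.trans_eq (two_mul η).symm) fun G hG => ?_
  simp only [Set.mem_union, Set.mem_ofPred_eq, not_or, not_not, not_lt] at hG
  obtain ⟨hGM, hGS⟩ := hG
  refine ofReal_le_lintegral_of_measureReal_le _ (by linarith) (by linarith)
    ((measureReal_union_le _ _).trans (add_le_add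
      (measureReal_uniformOn_lt_cost_le hn P (one_div_pos.2 hη0))
      (measureReal_uniformOn_lt_cost_le hn (jlProject G P) (one_div_pos.2 hη0)))
      |>.trans_eq (by rw [one_div_one_div, two_mul])) fun i₀ hi₀ => ?_
  simp only [Set.mem_union, Set.mem_ofPred_eq, not_or, not_lt] at hi₀
  obtain ⟨hcost, hcost'⟩ := hi₀
  have hspread' : 0 ≤ spread (jlProject G P) / n :=
    div_nonneg (spread_nonneg _) (Nat.cast_nonneg n)
  have hbad := measureReal_samplingLaw_not_isLocalCoreset_le hn hk hα P (jlProject G P) i₀ hC hinv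
    hb hε hε1 hr0 hr (fun i => hGM i i₀) hcost (hcost'.trans (by
      rw [div_mul_eq_mul_div (1 / η), mul_div_assoc (1 / η)]
      refine mul_le_mul_of_nonneg_left ?_ (by positivity)
      rw [le_div_iff₀ hη0, div_mul_eq_mul_div]
      exact div_le_div_of_nonneg_right (by linarith) (by linarith)))
  -- The projected instance is compared with itself; the larger b is kept so that both errors have
  -- the same K.
  have hbad' := measureReal_samplingLaw_not_isLocalCoreset_le hn hk hα (jlProject G P)
    (jlProject G P) i₀ hC hinv hb hε hε1 hr0 hr
    (fun i => by linarith [matchCost_nonneg (jlProject G P i) (jlProject G P i₀)]) hcost'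
    (hcost'.trans (mul_le_mul_of_nonneg_right
      (le_div_self (by positivity) hη0 (by linarith)) hspread'))
  rw [hCη] at hbad hbad'
  have : IsProbabilityMeasure (samplingLaw α (jlProject G P) i₀) :=
    isProbabilityMeasure_weightedLaw (fun i => (sampleProb_pos hn hα (jlProject G P) i₀ i).le)
      (sum_sampleProb hn hα (jlProject G P) i₀)
  rw [← ofReal_measureReal]
  refine ENNReal.ofReal_le_ofReal ?_
  rw [two_mul]
  exact le_measureReal_and _ hbad hbad'
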